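/- Let $\mathcal S$ be a disjoint union of finitely many circles with a smooth involution $\sigma$ whose fixed points are isolated. Write $\mathcal S^{\mathbb Z_2}=\{t:\sigma(t)=t\}$ and $\mathcal S^-=\mathcal S\setminus\mathcal S^{\mathbb Z_2}$. Let $\tau(x,y)=(-x,y)$ be the reflection of $\mathbb R^2$ in the axis $\mathcal L=\{x=0\}$. A smooth map $\phi\colon\mathcal S\to\mathbb R^2$ is called equivariant if $\phi\circ\sigma=\tau\circ\phi$; write $\phi'$ for its derivative along the circles. Let $\mathcal F$ be the space, with the $C^\infty$ topology, of all equivariant smooth maps $\phi\colon\mathcal S\to\mathbb R^2$ that take distinct points of $\mathcal S^{\mathbb Z_2}$ to distinct points of $\mathcal L$, and let $\mathcal F^0\subset\mathcal F$ be the set of those $\phi \in \mathcal F$ which satisfy: - (ER-1) $\phi'$ is nonzero at every point of $\mathcal S^-$; - (ER-2) for any $w\in\mathbb R^2\setminus\mathcal L$, if $\phi^{-1}(w)$ consists of two points $t_1,t_2$, then $\phi'(t_1),\phi'(t_2)$ are linearly independent; - (ER-3) for any $w\in\mathbb R^2\setminus\mathcal L$, the preimage $\phi^{-1}(w)$ consists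 of at most two points; - (ER-4) if $t\in\mathcal S^-$ and $\phi(t)\in\mathcal L$, then $\phi'(t)$ is not tangent to $\mathcal L$; - (ER-5) if $t\in\mathcal S^-$ and $\phi(t)\in\mathcal L$, then $\phi'(t)$ is not perpendicular to $\mathcal L$; - (ER-6) if $t_1,t_2\in\mathcal S^-$ and $\phi(t_1),\phi(t_2)\in\mathcal L$, then $\phi(t_1)\ne\phi(t_2)$ unless $t_1,t_2$ lie in the same orbit of $\sigma$; - (ER-7) $\phi'$ is nonzero at every point of $\mathcal S^{\mathbb Z_2}$; - (ER-8) $\phi(\mathcal S^-)$ and $\phi(\mathcal S^{\mathbb Z_2})$ are disjoint. (The zero vector counts as both tangent and perpendicular to $\mathcal L$.) Then: 1. $\mathcal F^0$ is an open dense subset of $\mathcal F$. 2. An equivariant smooth map $\phi\colon\mathcal S\to\mathbb R^2$ belongs to $\mathcal F^0$ if and only if it is regular as a non-equivariant map, that is: (no cusps) $\phi'$ is nonzero at every point of $\mathcal S$; (no tangencies) for any $w\in\mathbb R^2$, if $\phi^{-1}(w)$ consists of two points $t_1,t_2$, then $\phi'(t_1),\phi'(t_2)$ are linearly independent; (no triple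 points) for any $w\in\mathbb R^2$, the preimage $\phi^{-1}(w)$ consists of at most two points. -/

import Mathlib

open scoped Manifold ContDiff

noncomputable section

namespace InvolutiveDiagram

/-- The Euclidean plane. -/
abbrev Plane : Type := EuclideanSpace ℝ (Fin 2)

/-- The disjoint union of copies of the unit circle indexed by `ι`
(with the disjoint union topology). -/
abbrev Circles (ι : Type*) : Type _ := Σ _ : ι, Circle

/-- The reflection `(x, y) ↦ (-x, y)` of the plane. -/
def reflection (w : Plane) : Plane := !₂[-w 0, w 1]

/-- The fixed axis of the reflection, i.e. the `y`-axis `{x = 0}`. -/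
def axis : Submodule ℝ Plane where
  carrier := {w | w 0 = 0}
  add_mem' := by
    intro a b ha hb
    change (a + b) 0 = 0
    rw [PiLp.add_apply, show a 0 = 0 from ha, show b 0 = 0 from hb, add_zero]
  zero_mem' := by simp
  smul_mem' := by
    intro c a ha
    change (c • a) 0 = 0
    rw [PiLp.smul_apply, show a 0 = 0 from ha, smul_zero]

/-- A smooth involution of a disjoint union of circles whose fixed points are isolated.
Smoothness of a self-map of the disjoint union means that it is continuous and that its
restriction to each circle is, as a map between circles, smooth. -/
structure IsSmoothInvolution {ι : Type*} (σ : Circles ι → Circles ι) : Prop where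
  involutive : Function.Involutive σ
  continuous : Continuous σ
  smooth : ∀ i : ι, ContMDiff (𝓡 1) (𝓡 1) ∞ (fun z : Circle => (σ ⟨i, z⟩).2)
  isolated : ∀ t : Circles ι, σ t = t → ∀ᶠ s in nhdsWithin t {t}ᶜ, σ s ≠ s

/-- The space of smooth maps from a disjoint union of circles to the plane. -/
structure SmoothMap (ι : Type*) where
  toFun : Circles ι → Plane
  smooth : ∀ i : ι, ContMDiff (𝓡 1) 𝓘(ℝ, Plane) ∞ (fun z : Circle => toFun ⟨i, z⟩)

instance {ι : Type*} : CoeFun (SmoothMap ι) (fun _ => Circles ι → Plane) := ⟨SmoothMap.toFun⟩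

/-- The `k`-th derivative of a map with respect to the angular coordinate of the circles. -/
def angularDeriv {ι : Type*} (k : ℕ) (φ : Circles ι → Plane) (t : Circles ι) : Plane :=
  iteratedDeriv k (fun θ : ℝ => φ ⟨t.1, t.2 * Circle.exp θ⟩) 0

/-- The velocity vector `φ'(t)`. -/
def velocity {ι : Type*} (φ : Circles ι → Plane) (t : Circles ι) : Plane :=
  angularDeriv 1 φ t

/-- The `C^∞` topology: uniform convergence of the derivatives of every order. -/
instance smoothTopology (ι : Type*) : TopologicalSpace (SmoothMap ι) :=
  ⨅ k : ℕ, TopologicalSpace.induced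
    (fun φ : SmoothMap ι => UniformFun.ofFun (angularDeriv k φ)) inferInstance

/-- Regular maps, in the non-equivariant sense: no cusps, no tangencies, no triple points. -/
structure IsRegular {ι : Type*} (φ : Circles ι → Plane) : Prop where
  reg1 : ∀ t, velocity φ t ≠ 0
  reg2 : ∀ w : Plane, ∀ t₁ t₂, t₁ ≠ t₂ → φ ⁻¹' {w} = {t₁, t₂} →
    LinearIndependent ℝ ![velocity φ t₁, velocity φ t₂]
  reg3 : ∀ w : Plane, (φ ⁻¹' {w}).encard ≤ 2

/-- Equivariance with respect to `σ` and the reflection of the plane. -/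
def IsEquivariant {ι : Type*} (σ : Circles ι → Circles ι) (φ : Circles ι → Plane) : Prop :=
  ∀ t, φ (σ t) = reflection (φ t)

/-- The eight conditions of equivariant regularity. The points with `σ t ≠ t` are those on which the
involution acts freely. -/
structure SatisfiesER {ι : Type*} (σ : Circles ι → Circles ι) (φ : Circles ι → Plane) :
    Prop where
  er1 : ∀ t, σ t ≠ t → velocity φ t ≠ 0
  er2 : ∀ w : Plane, w ∉ axis → ∀ t₁ t₂, t₁ ≠ t₂ → φ ⁻¹' {w} = {t₁, t₂} →
    LinearIndependent ℝ ![velocity φ t₁, velocity φ t₂]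
  er3 : ∀ w : Plane, w ∉ axis → (φ ⁻¹' {w}).encard ≤ 2
  er4 : ∀ t, σ t ≠ t → φ t ∈ axis → velocity φ t ∉ axis
  er5 : ∀ t, σ t ≠ t → φ t ∈ axis → velocity φ t ∉ axisᗮ
  er6 : ∀ t₁ t₂, σ t₁ ≠ t₁ → σ t₂ ≠ t₂ → φ t₁ ∈ axis → φ t₂ ∈ axis →
    ¬ (t₁ = t₂ ∨ t₁ = σ t₂) → φ t₁ ≠ φ t₂
  er7 : ∀ t, σ t = t → velocity φ t ≠ 0
  er8 : Disjoint (φ '' {t | σ t ≠ t}) (φ '' {t | σ t = t})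

/-- The space of smooth equivariant maps that send distinct fixed points of the involution to
distinct points (which lie on the axis by equivariance). -/
def equivariantMaps {ι : Type*} (σ : Circles ι → Circles ι) : Set (SmoothMap ι) :=
  {φ | IsEquivariant σ φ ∧ Set.InjOn φ {t | σ t = t}}

/-- The equivariant regular maps. -/
def equivariantRegularMaps {ι : Type*} (σ : Circles ι → Circles ι) : Set (SmoothMap ι) :=
  {φ | φ ∈ equivariantMaps σ ∧ SatisfiesER σ φ}

end InvolutiveDiagram

end

/-! The characterisation in part 2 is pointwise. Differentiating φ ∘ σ = τ ∘ φ gives c • φ'(σ t) =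
τ(φ'(t)) for some scalar c. If t is free and φ(t) lies on the axis, then t and σ t are a double
point whose velocities are mirror images up to scale; they are independent exactly when both
coordinates of φ'(t) are nonzero, which is ER-4 with ER-5. ER-6, ER-8 and injectivity on fixed
points exclude every other coincidence on the axis. At a fixed point σ reverses the circle, so φ' is
perpendicular to the axis; hence two fixed points with one image would be tangent, and a regular map
is injective on them (`mem_equivariantRegularMaps_iff`).

Openness then reduces to openness of ordinary regularity, a compactness argument over pairs and
triples of points. Near the diagonals, a nonzero velocity gives injectivity uniformly in the map
(`SmoothMap.eventually_isRegular`).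

Density uses a finite-dimensional family φ + P_a, where P_a(t) = p(t) + τ(p(σ t)) and p is a complex
polynomial on each circle. Each failure of regularity is a zero of some c(x) + A(x)a, where x ranges
over a space of smaller dimension than the target. Where A(x) is surjective, almost every a has no
such zero (`ae_forall_affine_ne_zero`); surjectivity is Hermite interpolation (`exists_poly_jet`).
So almost every a, in particular some arbitrarily small a, gives a regular map. -/

noncomputable section

namespace InvolutiveDiagram

open Set Filter Topology MeasureTheory Module

/-! ### Parametric transversality for affine families -/

section Transversality

variable {X E F : Type*} [NormedAddCommGroup X] [NormedSpace ℝ X] [FiniteDimensional ℝ X]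
  [NormedAddCommGroup E] [NormedSpace ℝ E] [FiniteDimensional ℝ E] [MeasurableSpace E]
  [BorelSpace E] [NormedAddCommGroup F] [NormedSpace ℝ F]

/-- A `C¹` image of a space of smaller dimension avoids almost every point. -/
theorem ae_notMem_image_of_finrank_lt [MeasurableSpace F] [BorelSpace F] {f : X → F} {s : Set X}
    (hf : ContDiffOn ℝ 1 f s) (hs : Convex ℝ s) (hd : finrank ℝ X < finrank ℝ F) :
    ∀ᵐ y ∂(Measure.hausdorffMeasure (finrank ℝ F) : Measure F), y ∉ f '' s := by
  rw [ae_iff]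
  simp only [not_not]
  have h1 : dimH (f '' s) < (finrank ℝ F : NNReal) := by
    calc dimH (f '' s) ≤ dimH s := hf.dimH_image_le hs Subset.rfl
      _ ≤ dimH (univ : Set X) := dimH_mono (subset_univ _)
      _ = finrank ℝ X := Real.dimH_univ_eq_finrank X
      _ < (finrank ℝ F : NNReal) := by exact_mod_cast hd
  have := hausdorffMeasure_of_dimH_lt h1
  exact (by simpa using this : Measure.hausdorffMeasure (finrank ℝ F) (f '' s) = 0)

variable [FiniteDimensional ℝ F]

/-- With B a right inverse of A(x₀), the map M(x) = A(x)B stays invertible near x₀. On a slice a +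
By, a zero at x forces y = -M(x)⁻¹(c(x) + A(x)a), so the bad y form a C¹ image of a ball of
dimension below that of F, hence a null set. -/
theorem eventually_ae_forall_affine_ne_zero {c : X → F} {A : X → E →L[ℝ] F}
    (hc : ContDiff ℝ 1 c) (hA : ContDiff ℝ 1 A) (hd : finrank ℝ X < finrank ℝ F)
    (μ : Measure E) [μ.IsAddHaarMeasure] (x₀ : X) (hx₀ : Function.Surjective (A x₀)) :
    ∃ s ∈ 𝓝 x₀, ∀ᵐ a ∂μ, ∀ x ∈ s, c x + A x a ≠ 0 := by
  borelize F
  obtain ⟨B₀, hB₀⟩ := (A x₀ : E →ₗ[ℝ] F).exists_rightInverse_of_surjective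
    (LinearMap.range_eq_top.2 hx₀)
  set B : F →L[ℝ] E := B₀.toContinuousLinearMap with hB
  set M : X → F →L[ℝ] F := fun x => (A x).comp B with hM
  have hMc : ContDiff ℝ 1 M := hA.clm_comp contDiff_const
  have hM0 : M x₀ = 1 := by
    ext y
    exact congrArg (fun l : F →ₗ[ℝ] F => l y) hB₀
  have hU : M ⁻¹' {m | IsUnit m} ∈ 𝓝 x₀ :=
    (Units.isOpen.preimage hMc.continuous).mem_nhds (by simp [hM0])
  obtain ⟨r, hr, hrU⟩ := Metric.nhds_basis_closedBall.mem_iff.1 hU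
  refine ⟨_, Metric.closedBall_mem_nhds x₀ hr, ?_⟩
  -- Projecting a closed set along a compact ball; this supplies the measurability needed to
  -- integrate over slices.
  have hcl : IsClosed {a : E | ∃ x ∈ Metric.closedBall x₀ r, c x + A x a = 0} := by
    have h1 : IsClosed {p : E × X | c p.2 + A p.2 p.1 = 0} := by
      refine isClosed_eq ?_ continuous_const
      exact (hc.continuous.comp continuous_snd).add
        ((hA.continuous.comp continuous_snd).clm_apply continuous_fst)
    have hK := isCompact_closedBall x₀ r
    rw [← isSeqClosed_iff_isClosed]
    intro u a hu hua
    choose x hx hx' using hu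
    obtain ⟨x', hx'K, φ, hφ, hlim⟩ := hK.tendsto_subseq hx
    refine ⟨x', hx'K, ?_⟩
    have := h1.mem_of_tendsto ((hua.comp hφ.tendsto_atTop).prodMk_nhds hlim)
      (Eventually.of_forall fun n => hx' (φ n))
    exact this
  have hmeas : MeasurableSet {a : E | ∀ x ∈ Metric.closedBall x₀ r, c x + A x a ≠ 0} := by
    convert! hcl.measurableSet.compl using 1
    ext a
    simp
  -- Fubini along the translates of the range of B, with Hausdorff measure as the Haar measure of F.
  refine ae_mem_of_ae_add_linearMap_mem (𝕜 := ℝ) (B : F →ₗ[ℝ] E)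
    (Measure.hausdorffMeasure (finrank ℝ F)) μ hmeas fun a => ?_
  have hinv : ContDiffOn ℝ 1 (fun x => -(Ring.inverse (M x) (c x + A x a)))
      (Metric.closedBall x₀ r) := by
    intro x hx
    refine ContDiffAt.contDiffWithinAt ?_
    obtain ⟨m, hm⟩ := hrU hx
    have h1 : ContDiffAt ℝ 1 (fun x => Ring.inverse (M x)) x := by
      refine ContDiffAt.comp x (g := Ring.inverse) ?_ hMc.contDiffAt
      rw [← hm]
      exact contDiffAt_ringInverse ℝ m
    exact (h1.clm_apply (hc.contDiffAt.add (hA.contDiffAt.clm_apply contDiffAt_const))).neg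
  filter_upwards [ae_notMem_image_of_finrank_lt hinv (convex_closedBall _ _) hd] with y hy x hx h0
  refine hy ⟨x, hx, ?_⟩
  have h1 : c x + A x a = -(M x y) := by
    rw [eq_neg_iff_add_eq_zero, ← h0]
    simp [hM, add_assoc]
  have h2 := Ring.inverse_mul_cancel (M x) (hrU hx)
  simp only [h1, map_neg, neg_neg]
  exact congrArg (fun l : F →L[ℝ] F => l y) h2

/-- Parametric transversality for affine families: for almost every parameter, the section
`x ↦ c x + A x a` has no zeros among the points at which `A x` is surjective, provided that the
target has larger dimension than the source. -/
theorem ae_forall_affine_ne_zero {c : X → F} {A : X → E →L[ℝ] F}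
    (hc : ContDiff ℝ 1 c) (hA : ContDiff ℝ 1 A) (hd : finrank ℝ X < finrank ℝ F)
    (μ : Measure E) [μ.IsAddHaarMeasure] :
    ∀ᵐ a ∂μ, ∀ x, Function.Surjective (A x) → c x + A x a ≠ 0 := by
  choose! s hs hs' using fun x hx =>
    eventually_ae_forall_affine_ne_zero hc hA hd μ x hx
  have : SecondCountableTopology X := by
    have := FiniteDimensional.proper ℝ X
    infer_instance
  obtain ⟨t, hts, htc, ht⟩ := TopologicalSpace.countable_cover_nhdsWithin
    (s := {x | Function.Surjective (A x)}) (f := s) fun x hx => mem_nhdsWithin_of_mem_nhds (hs x hx)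
  filter_upwards [(ae_ball_iff htc).2 fun x hx => hs' x (hts hx)] with a ha x hx
  obtain ⟨y, hy, hxy⟩ := mem_iUnion₂.1 (ht hx)
  exact ha y hy x hxy

end Transversality

end InvolutiveDiagram

/-! ### Angular coordinates and local lifts of the involution -/

namespace InvolutiveDiagram

open Set Filter Topology

variable {ι : Type*}

/-- The point with angle `θ` on the `i`-th circle. -/
def pt (i : ι) (θ : ℝ) : Circles ι := ⟨i, Circle.exp θ⟩

theorem exists_pt_eq (t : Circles ι) : ∃ i θ, pt i θ = t :=
  ⟨t.1, Complex.arg t.2, by rw [pt, Circle.exp_arg]⟩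

theorem exists_mem_Icc_pt_eq (t : Circles ι) :
    ∃ i, ∃ θ ∈ Icc (-Real.pi) Real.pi, pt i θ = t :=
  ⟨t.1, Complex.arg t.2, ⟨(Complex.neg_pi_lt_arg _).le, Complex.arg_le_pi _⟩,
    by rw [pt, Circle.exp_arg]⟩

theorem continuous_pt (i : ι) : Continuous (pt i) :=
  continuous_sigmaMk.comp Circle.exp.continuous

theorem nhds_pt (i : ι) (θ : ℝ) : 𝓝 (pt i θ) = map (pt i) (𝓝 θ) := by
  rw [pt, Sigma.nhds_mk, ← isLocalHomeomorph_circleExp.map_nhds_eq θ, Filter.map_map]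
  rfl

theorem eventually_pt_eq_imp (i : ι) (θ : ℝ) :
    ∀ᶠ p : ℝ × ℝ in 𝓝 (θ, θ), pt i p.1 = pt i p.2 → p.1 = p.2 := by
  obtain ⟨U, hU, hθ, hinj⟩ := isLocalHomeomorph_circleExp.isLocallyInjective θ
  filter_upwards [(hU.prod hU).mem_nhds ⟨hθ, hθ⟩] with p hp h
  exact hinj hp.1 hp.2 (by simpa [pt] using h)

theorem angularDeriv_pt (k : ℕ) (f : Circles ι → Plane) (i : ι) (θ : ℝ) :
    angularDeriv k f (pt i θ) = iteratedDeriv k (fun s => f (pt i s)) θ := by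
  have h := iteratedDeriv_comp_const_add k (fun s => f (pt i s)) θ
  have := congrFun h 0
  simp only [add_zero] at this
  rw [← this]
  simp only [angularDeriv, pt, Circle.exp_add]

theorem velocity_pt (f : Circles ι → Plane) (i : ι) (θ : ℝ) :
    velocity f (pt i θ) = deriv (fun s => f (pt i s)) θ := by
  rw [velocity, angularDeriv_pt, iteratedDeriv_one]

theorem SmoothMap.contDiff_pt (φ : SmoothMap ι) (i : ι) :
    ContDiff ℝ ∞ (fun θ => φ (pt i θ)) :=
  ((φ.smooth i).comp contMDiff_circleExp).contDiff

theorem SmoothMap.hasDerivAt_pt (φ : SmoothMap ι) (i : ι) (θ : ℝ) :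
    HasDerivAt (fun s => φ (pt i s)) (velocity φ (pt i θ)) θ := by
  rw [velocity_pt]
  exact (((φ.contDiff_pt i).differentiable (by simp)) θ).hasDerivAt

theorem SmoothMap.continuous_angularDeriv (φ : SmoothMap ι) (k : ℕ) :
    Continuous (angularDeriv k φ) := by
  rw [continuous_iff_continuousAt]
  intro t
  obtain ⟨i, θ, rfl⟩ := exists_pt_eq t
  rw [ContinuousAt, nhds_pt, tendsto_map'_iff, angularDeriv_pt]
  have : angularDeriv k φ ∘ pt i = iteratedDeriv k (fun s => φ (pt i s)) :=
    funext fun s => angularDeriv_pt k φ i s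
  rw [this]
  exact ((φ.contDiff_pt i).continuous_iteratedDeriv k (by exact_mod_cast le_top)).tendsto θ

theorem angularDeriv_zero (f : Circles ι → Plane) (t : Circles ι) : angularDeriv 0 f t = f t := by
  obtain ⟨i, θ, rfl⟩ := exists_pt_eq t
  rw [angularDeriv_pt, iteratedDeriv_zero]

section Involution

variable {σ : Circles ι → Circles ι}

/-- A circle is connected, so its image lies in a single circle. -/
theorem IsSmoothInvolution.fst_eq (hσ : IsSmoothInvolution σ) (i : ι) (θ : ℝ) :
    (σ (pt i θ)).1 = (σ (pt i 0)).1 := by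
  let _ : TopologicalSpace ι := ⊥
  have : DiscreteTopology ι := ⟨rfl⟩
  have hfst : Continuous (Sigma.fst : Circles ι → ι) :=
    continuous_sigma fun i => continuous_const
  exact isPreconnected_univ.constant
    ((hfst.comp (hσ.continuous.comp (continuous_pt i))).continuousOn) (mem_univ _) (mem_univ _)

theorem IsSmoothInvolution.contDiff_coe (hσ : IsSmoothInvolution σ) (i : ι) :
    ContDiff ℝ ∞ (fun θ => ((σ (pt i θ)).2 : ℂ)) := by
  have : Fact (Module.finrank ℝ ℂ = 1 + 1) := finrank_real_complex_fact'
  have h : ContMDiff (𝓡 1) 𝓘(ℝ, ℂ) ∞ (fun z : Circle => (z : ℂ)) :=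
    contMDiff_coe_sphere
  exact ((h.comp (hσ.smooth i)).comp contMDiff_circleExp).contDiff

/-- An involution is described near any point by a smooth function of the angle. -/
theorem IsSmoothInvolution.exists_lift (hσ : IsSmoothInvolution σ) {i j : ι} {θ₀ θ₁ : ℝ}
    (h₀ : σ (pt i θ₀) = pt j θ₁) :
    ∃ H : ℝ → ℝ, ContDiffAt ℝ ∞ H θ₀ ∧ H θ₀ = θ₁ ∧ ∀ θ, σ (pt i θ) = pt j (H θ) := by
  have hj : ∀ θ, (σ (pt i θ)).1 = j := fun θ => by
    rw [hσ.fst_eq, ← hσ.fst_eq i θ₀, h₀]; rfl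
  have h1 : ((σ (pt i θ₀)).2 : ℂ) * (Circle.exp (-θ₁) : ℂ) = 1 := by
    rw [h₀, pt, ← Circle.coe_mul, ← Circle.exp_add]
    simp
  -- The argument of σ(θ) relative to θ₁. At θ₀ the logarithm is taken at 1, away from the cut, so H
  -- is smooth there; the lifting identity survives the cut and holds for every θ.
  refine ⟨fun θ => θ₁ + (Complex.log (((σ (pt i θ)).2 : ℂ) * (Circle.exp (-θ₁) : ℂ))).im, ?_, ?_, ?_⟩
  · refine contDiffAt_const.add ?_
    have h2 : ContDiffAt ℝ ∞
        (fun θ => Complex.log (((σ (pt i θ)).2 : ℂ) * (Circle.exp (-θ₁) : ℂ))) θ₀ := by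
      refine ContDiffAt.comp θ₀ (g := Complex.log) ?_
        ((hσ.contDiff_coe i).contDiffAt.mul contDiffAt_const)
      rw [h1]
      exact (Complex.contDiffAt_log (by simp)).restrict_scalars ℝ
    exact Complex.imCLM.contDiff.contDiffAt.comp θ₀ h2
  · simp only [h1, Complex.log_one, Complex.zero_im, add_zero]
  · intro θ
    have h3 : Circle.exp (θ₁ + (Complex.log (((σ (pt i θ)).2 : ℂ) * (Circle.exp (-θ₁) : ℂ))).im)
        = (σ (pt i θ)).2 := by
      rw [Circle.exp_add, Complex.log_im, ← Circle.coe_mul, Circle.exp_arg, mul_comm, mul_assoc,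
        ← Circle.exp_add]
      simp
    exact Sigma.ext (hj θ) (heq_of_eq h3.symm)

/-- At a fixed point, the involution reverses the direction of the circle. -/
theorem IsSmoothInvolution.exists_lift_of_fixed (hσ : IsSmoothInvolution σ) {i : ι} {θ₀ : ℝ}
    (h₀ : σ (pt i θ₀) = pt i θ₀) :
    ∃ H : ℝ → ℝ, HasDerivAt H (-1) θ₀ ∧ H θ₀ = θ₀ ∧ ∀ θ, σ (pt i θ) = pt i (H θ) := by
  obtain ⟨H, hH, hHθ, hHσ⟩ := hσ.exists_lift h₀
  have hs : HasStrictDerivAt H (deriv H θ₀) θ₀ := hH.hasStrictDerivAt (by simp)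
  have hinv : ∀ᶠ θ in 𝓝 θ₀, H (H θ) = θ := by
    have h1 : Tendsto (fun θ => (H (H θ), θ)) (𝓝 θ₀) (𝓝 (θ₀, θ₀)) := by
      refine Tendsto.prodMk_nhds ?_ tendsto_id
      have h2 := hH.continuousAt.tendsto
      rw [hHθ] at h2
      exact (h2.comp h2)
    filter_upwards [h1.eventually (eventually_pt_eq_imp i θ₀)] with θ hθ
    apply hθ
    rw [← hHσ, ← hHσ, hσ.involutive]
  refine ⟨H, ?_, hHθ, hHσ⟩
  have hd := hs.hasDerivAt
  -- As H ∘ H is the identity near θ₀, the derivative squares to 1.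
  have hsq : deriv H θ₀ * deriv H θ₀ = 1 := by
    have h1 : HasDerivAt (H ∘ H) (deriv H θ₀ * deriv H θ₀) θ₀ :=
      HasDerivAt.comp θ₀ (by rw [hHθ]; exact hd) hd
    have h2 : HasDerivAt (H ∘ H) 1 θ₀ := (hasDerivAt_id θ₀).congr_of_eventuallyEq hinv
    exact h1.unique h2
  rcases mul_self_eq_one_iff.1 hsq with h1 | h1
  · exfalso
    -- If H' = 1, then u(θ) = θ + H(θ) is injective near θ₀, while u(H(θ)) = u(θ). So H is the
    -- identity there and the fixed point is not isolated.
    have hu : HasStrictDerivAt (fun θ => θ + H θ) (1 + deriv H θ₀) θ₀ :=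
      (hasStrictDerivAt_id θ₀).add hs
    have hne : 1 + deriv H θ₀ ≠ 0 := by rw [h1]; norm_num
    have hleft := (hu.hasStrictFDerivAt_equiv hne).eventually_left_inverse
    have hT : Tendsto H (𝓝 θ₀) (𝓝 θ₀) := by
      have := hH.continuousAt.tendsto
      rwa [hHθ] at this
    have hid : ∀ᶠ θ in 𝓝 θ₀, H θ = θ := by
      filter_upwards [hleft, hT.eventually hleft, hinv] with θ h2 h3 h4
      rw [h4, add_comm (H θ) θ] at h3
      exact h3.symm.trans h2
    have hfix : ∀ᶠ s in 𝓝 (pt i θ₀), σ s = s := by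
      rw [nhds_pt, eventually_map]
      filter_upwards [hid] with θ hθ
      rw [hHσ, hθ]
    have hno := (hσ.isolated _ h₀).and (hfix.filter_mono nhdsWithin_le_nhds)
    have hbot : (𝓝[≠] (pt i θ₀)).NeBot := by
      rw [← mem_closure_iff_nhdsWithin_neBot, mem_closure_iff_nhds]
      intro U hU
      rw [nhds_pt, mem_map] at hU
      have h5 : ∀ᶠ θ in 𝓝 θ₀, pt i θ = pt i θ₀ → θ = θ₀ :=
        (Tendsto.prodMk_nhds tendsto_id tendsto_const_nhds).eventually (eventually_pt_eq_imp i θ₀)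
      have h6 : ∀ᶠ θ in 𝓝[≠] θ₀, pt i θ ∈ U ∧ pt i θ ≠ pt i θ₀ := by
        filter_upwards [nhdsWithin_le_nhds hU, nhdsWithin_le_nhds h5, self_mem_nhdsWithin]
          with θ h7 h8 h9
        exact ⟨h7, fun h => h9 (h8 h)⟩
      obtain ⟨θ, h7, h8⟩ := h6.exists
      exact ⟨_, h7, h8⟩
    obtain ⟨s, hs1, hs2⟩ := hno.exists
    exact hs1 hs2
  · rwa [h1] at hd

end Involution

end InvolutiveDiagram

/-! ### Equivariant regularity against ordinary regularity -/

namespace InvolutiveDiagram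

open Set Filter Topology

variable {ι : Type*}

theorem mem_axis {w : Plane} : w ∈ axis ↔ w 0 = 0 := Iff.rfl

theorem mem_axis_orthogonal {w : Plane} : w ∈ axisᗮ ↔ w 1 = 0 := by
  rw [Submodule.mem_orthogonal]
  constructor
  · intro h
    have := h !₂[0, 1] (by simp [mem_axis])
    simpa [PiLp.inner_apply, Fin.sum_univ_two] using this
  · intro h u hu
    rw [mem_axis] at hu
    simp [PiLp.inner_apply, Fin.sum_univ_two, h, hu]

theorem plane_ext {v w : Plane} (h0 : v 0 = w 0) (h1 : v 1 = w 1) : v = w := by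
  ext k
  fin_cases k <;> assumption

/-- The reflection as a continuous linear map. -/
def reflectionCLM : Plane →L[ℝ] Plane :=
  LinearMap.toContinuousLinearMap
    { toFun := reflection
      map_add' := fun v w => plane_ext (by simp [reflection]; ring) (by simp [reflection])
      map_smul' := fun c w => plane_ext (by simp [reflection]) (by simp [reflection]) }

@[simp]
theorem reflectionCLM_apply (w : Plane) : reflectionCLM w = reflection w := rfl

@[simp]
theorem reflection_apply_zero (w : Plane) : reflection w 0 = -w 0 := by simp [reflection]

@[simp]
theorem reflection_apply_one (w : Plane) : reflection w 1 = w 1 := by simp [reflection]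

theorem reflection_eq_self_iff {w : Plane} : reflection w = w ↔ w ∈ axis := by
  rw [mem_axis]
  refine ⟨fun h => ?_, fun h => plane_ext (by simp [h]) (by simp)⟩
  have := congrArg (fun v : Plane => v 0) h
  simp only [reflection_apply_zero] at this
  linarith

theorem linearIndependent_plane_iff {v w : Plane} :
    LinearIndependent ℝ ![v, w] ↔ v 0 * w 1 - v 1 * w 0 ≠ 0 := by
  rw [LinearIndependent.pair_iff]
  constructor
  · intro h h0
    have h1 := h (w 1) (-(v 1)) (plane_ext (by simp; linarith) (by simp; ring))
    have h2 := h (w 0) (-(v 0)) (plane_ext (by simp; ring) (by simp; linarith))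
    have h3 := h 1 1 (plane_ext (by simp [neg_eq_zero.1 h2.2, h2.1])
      (by simp [neg_eq_zero.1 h1.2, h1.1]))
    exact one_ne_zero h3.1
  · intro h s t hst
    have h0 := congrArg (fun u : Plane => u 0) hst
    have h1 := congrArg (fun u : Plane => u 1) hst
    simp at h0 h1
    constructor
    · refine (mul_eq_zero.1 (?_ : s * (v 0 * w 1 - v 1 * w 0) = 0)).resolve_right h
      linear_combination w 1 * h0 - w 0 * h1
    · refine (mul_eq_zero.1 (?_ : t * (v 0 * w 1 - v 1 * w 0) = 0)).resolve_right h
      linear_combination v 0 * h1 - v 1 * h0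

theorem encard_preimage_le_two_iff {α β : Type*} {f : α → β} {w : β} :
    (f ⁻¹' {w}).encard ≤ 2 ↔ ∀ t₁ t₂ t₃, t₁ ≠ t₂ → t₁ ≠ t₃ → t₂ ≠ t₃ →
      f t₁ = w → f t₂ = w → f t₃ ≠ w := by
  constructor
  · intro h t₁ t₂ t₃ h12 h13 h23 h1 h2 h3
    have hsub : ({t₁, t₂, t₃} : Set α) ⊆ f ⁻¹' {w} := by
      rintro t (rfl | rfl | rfl) <;> assumption
    have := (Set.encard_le_encard hsub).trans h
    rw [Set.encard_eq_three.2 ⟨t₁, t₂, t₃, h12, h13, h23, rfl⟩] at this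
    exact absurd this (by decide)
  · intro h
    by_contra hlt
    have h3 : (3 : ℕ∞) ≤ (f ⁻¹' {w}).encard := by
      have := Order.add_one_le_of_lt (not_le.1 hlt)
      exact this
    obtain ⟨s, hs, hs3⟩ := Set.exists_subset_encard_eq h3
    obtain ⟨t₁, t₂, t₃, h12, h13, h23, rfl⟩ := Set.encard_eq_three.1 hs3
    exact h t₁ t₂ t₃ h12 h13 h23 (hs (by simp)) (hs (by simp)) (hs (by simp))

theorem disjoint_image_image_iff {α β : Type*} {f : α → β} {s t : Set α} :
    Disjoint (f '' s) (f '' t) ↔ ∀ a ∈ s, ∀ b ∈ t, f a ≠ f b := by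
  rw [Set.disjoint_left]
  constructor
  · exact fun h a ha b hb he => h ⟨a, ha, rfl⟩ ⟨b, hb, he.symm⟩
  · rintro h _ ⟨a, ha, rfl⟩ ⟨b, hb, he⟩
    exact h a ha b hb he.symm

theorem preimage_eq_pair {α β : Type*} {f : α → β} {w : β} {t₁ t₂ : α}
    (h : (f ⁻¹' {w}).encard ≤ 2) (h12 : t₁ ≠ t₂) (h1 : f t₁ = w) (h2 : f t₂ = w) :
    f ⁻¹' {w} = {t₁, t₂} := by
  rw [encard_preimage_le_two_iff] at h
  ext t
  simp only [mem_preimage, mem_singleton_iff, mem_insert_iff]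
  constructor
  · intro ht
    by_contra! hne
    exact h t₁ t₂ t h12 hne.1.symm hne.2.symm h1 h2 ht
  · rintro (rfl | rfl) <;> assumption

/-- Without triple points, two distinct points with one image exhaust the fibre. Quantifying over
tuples of points is the form suited to compactness. -/
theorem isRegular_iff {f : Circles ι → Plane} :
    IsRegular f ↔ (∀ t, velocity f t ≠ 0) ∧
      (∀ t₁ t₂, t₁ ≠ t₂ → f t₁ = f t₂ → LinearIndependent ℝ ![velocity f t₁, velocity f t₂]) ∧
      ∀ t₁ t₂ t₃, t₁ ≠ t₂ → t₁ ≠ t₃ → t₂ ≠ t₃ → f t₁ = f t₂ → f t₁ ≠ f t₃ := by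
  constructor
  · intro h
    refine ⟨h.reg1, fun t₁ t₂ h12 he => h.reg2 _ t₁ t₂ h12
      (preimage_eq_pair (h.reg3 (f t₁)) h12 rfl he.symm), fun t₁ t₂ t₃ h12 h13 h23 he he' => ?_⟩
    exact encard_preimage_le_two_iff.1 (h.reg3 (f t₁)) t₁ t₂ t₃ h12 h13 h23 rfl he.symm he'.symm
  · rintro ⟨h1, h2, h3⟩
    refine ⟨h1, fun w t₁ t₂ h12 hw => h2 t₁ t₂ h12 ?_, fun w => encard_preimage_le_two_iff.2 ?_⟩
    · have ha : t₁ ∈ f ⁻¹' {w} := by rw [hw]; simp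
      have hb : t₂ ∈ f ⁻¹' {w} := by rw [hw]; simp
      exact ha.trans hb.symm
    · intro t₁ t₂ t₃ h12 h13 h23 e1 e2 e3
      exact h3 t₁ t₂ t₃ h12 h13 h23 (e1.trans e2.symm) (e1.trans e3.symm)

section Equivariant

variable {σ : Circles ι → Circles ι} {φ : SmoothMap ι}

theorem SmoothMap.hasDerivAt_reflection (hφ : IsEquivariant σ φ) {i j : ι} {θ₀ d : ℝ} {H : ℝ → ℝ}
    (hH : HasDerivAt H d θ₀) (hσH : ∀ θ, σ (pt i θ) = pt j (H θ)) :
    d • velocity φ (σ (pt i θ₀)) = reflection (velocity φ (pt i θ₀)) := by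
  have h1 := (φ.hasDerivAt_pt j (H θ₀)).scomp θ₀ hH
  have h2 := reflectionCLM.hasFDerivAt.comp_hasDerivAt θ₀ (φ.hasDerivAt_pt i θ₀)
  rw [hσH]
  refine h1.unique (h2.congr_of_eventuallyEq (Eventually.of_forall fun θ => ?_))
  simp only [Function.comp, reflectionCLM_apply]
  rw [← hσH, hφ]

theorem exists_smul_velocity_eq_reflection (hσ : IsSmoothInvolution σ) (hφ : IsEquivariant σ φ)
    (t : Circles ι) : ∃ c : ℝ, c • velocity φ (σ t) = reflection (velocity φ t) := by
  obtain ⟨i, θ₀, rfl⟩ := exists_pt_eq t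
  obtain ⟨j, θ₁, h⟩ := exists_pt_eq (σ (pt i θ₀))
  obtain ⟨H, hH, -, hσH⟩ := hσ.exists_lift h.symm
  exact ⟨_, SmoothMap.hasDerivAt_reflection hφ
    (hH.differentiableAt (by simp)).hasDerivAt hσH⟩

/-- The lift has derivative -1, so -φ'(t) = τ(φ'(t)). -/
theorem velocity_apply_one_of_fixed (hσ : IsSmoothInvolution σ) (hφ : IsEquivariant σ φ)
    {t : Circles ι} (ht : σ t = t) : velocity φ t 1 = 0 := by
  obtain ⟨i, θ₀, rfl⟩ := exists_pt_eq t
  obtain ⟨H, hH, -, hσH⟩ := hσ.exists_lift_of_fixed ht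
  have := congrArg (fun v : Plane => v 1) (SmoothMap.hasDerivAt_reflection hφ hH hσH)
  simp only [ht, PiLp.smul_apply, reflection_apply_one, smul_eq_mul] at this
  linarith

theorem map_mem_axis_of_fixed {f : Circles ι → Plane} (hf : IsEquivariant σ f)
    {t : Circles ι} (ht : σ t = t) : f t ∈ axis := by
  rw [← reflection_eq_self_iff, ← hf, ht]

theorem map_eq_of_mem_axis {f : Circles ι → Plane} (hf : IsEquivariant σ f)
    {t : Circles ι} (ht : f t ∈ axis) : f (σ t) = f t := by
  rw [hf, reflection_eq_self_iff.2 ht]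

/-- An equivariant smooth map is equivariantly regular if and only if it is regular as a
non-equivariant map. -/
theorem mem_equivariantRegularMaps_iff (hσ : IsSmoothInvolution σ) (hφ : IsEquivariant σ φ) :
    φ ∈ equivariantRegularMaps σ ↔ IsRegular φ := by
  constructor
  · rintro ⟨⟨-, hinj⟩, h⟩
    -- On the axis the only coincidences left are those within a free orbit.
    have haxis : ∀ t₁ t₂, t₁ ≠ t₂ → φ t₁ = φ t₂ → φ t₁ ∈ axis → σ t₁ ≠ t₁ ∧ t₁ = σ t₂ := by
      intro t₁ t₂ hne he hax
      by_cases h1 : σ t₁ = t₁ <;> by_cases h2 : σ t₂ = t₂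
      · exact absurd (hinj h1 h2 he) hne
      · exact absurd he.symm (disjoint_image_image_iff.1 h.er8 t₂ h2 t₁ h1)
      · exact absurd he (disjoint_image_image_iff.1 h.er8 t₁ h1 t₂ h2)
      · refine ⟨h1, ?_⟩
        by_contra hno
        exact h.er6 t₁ t₂ h1 h2 hax (he ▸ hax) (by tauto) he
    refine isRegular_iff.2 ⟨fun t => ?_, fun t₁ t₂ hne he => ?_, fun t₁ t₂ t₃ h12 h13 h23 he he' => ?_⟩
    · by_cases ht : σ t = t
      · exact h.er7 t ht
      · exact h.er1 t ht
    · by_cases hax : φ t₁ ∈ axis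
      · obtain ⟨h1, h2⟩ := haxis t₁ t₂ hne he hax
        have h3 : t₂ = σ t₁ := by rw [h2, hσ.involutive]
        obtain ⟨c, hc⟩ := exists_smul_velocity_eq_reflection hσ hφ t₁
        have h4 := h.er4 t₁ h1 hax
        have h5 := h.er5 t₁ h1 hax
        rw [mem_axis] at h4
        rw [mem_axis_orthogonal] at h5
        rw [linearIndependent_plane_iff, h3]
        have e0 := congrArg (fun v : Plane => v 0) hc
        have e1 := congrArg (fun v : Plane => v 1) hc
        simp only [PiLp.smul_apply, smul_eq_mul, reflection_apply_zero, reflection_apply_one] at e0 e1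
        intro hdet
        -- Multiplying the determinant of φ'(t₁), φ'(σ t₁) by c gives twice this product.
        have : velocity φ t₁ 0 * velocity φ t₁ 1 = 0 := by
          linear_combination (c * hdet - velocity φ t₁ 0 * e1 + velocity φ t₁ 1 * e0) / 2
        rcases mul_eq_zero.1 this with h6 | h6
        · exact h4 h6
        · exact h5 h6
      · refine h.er2 (φ t₁) hax t₁ t₂ hne (preimage_eq_pair (h.er3 _ hax) hne rfl he.symm)
    · by_cases hax : φ t₁ ∈ axis
      · have h2 := (haxis t₁ t₂ h12 he hax).2
        have h3 := (haxis t₁ t₃ h13 he' hax).2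
        exact h23 (hσ.involutive.injective (h2.symm.trans h3))
      · exact encard_preimage_le_two_iff.1 (h.er3 _ hax) t₁ t₂ t₃ h12 h13 h23 rfl he.symm he'.symm
  · intro h
    obtain ⟨h1, h2, h3⟩ := isRegular_iff.1 h
    have hdet : ∀ t, σ t ≠ t → φ t ∈ axis →
        velocity φ t 0 ≠ 0 ∧ velocity φ t 1 ≠ 0 := by
      intro t ht hax
      obtain ⟨c, hc⟩ := exists_smul_velocity_eq_reflection hσ hφ t
      have hl := h2 (σ t) t ht (map_eq_of_mem_axis hφ hax)
      rw [linearIndependent_plane_iff] at hl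
      have e0 := congrArg (fun v : Plane => v 0) hc
      have e1 := congrArg (fun v : Plane => v 1) hc
      simp only [PiLp.smul_apply, smul_eq_mul, reflection_apply_zero, reflection_apply_one] at e0 e1
      have hc0 : c ≠ 0 := by
        rintro rfl
        exact h1 t (plane_ext (by simpa using e0.symm) (by simpa using e1.symm))
      constructor
      · intro h0
        have : velocity φ (σ t) 0 = 0 := by
          rw [h0, neg_zero] at e0
          exact (mul_eq_zero.1 e0).resolve_left hc0
        exact hl (by rw [this, h0]; ring)
      · intro h0
        have : velocity φ (σ t) 1 = 0 := by
          rw [h0] at e1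
          exact (mul_eq_zero.1 e1).resolve_left hc0
        exact hl (by rw [this, h0]; ring)
    refine ⟨⟨hφ, fun t₁ ht₁ t₂ ht₂ he => ?_⟩,
      ⟨fun t _ => h1 t, fun w _ => h.reg2 w, fun w _ => h.reg3 w,
        fun t ht hax => (hdet t ht hax).1,
        fun t ht hax h0 => (hdet t ht hax).2 (mem_axis_orthogonal.1 h0),
        fun t₁ t₂ ht₁ ht₂ hax₁ hax₂ hno he => ?_, fun t _ => h1 t, ?_⟩⟩
    · by_contra hne
      -- Velocities at fixed points are all perpendicular to the axis, hence parallel to each other.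
      refine linearIndependent_plane_iff.1 (h2 t₁ t₂ hne he) ?_
      rw [velocity_apply_one_of_fixed hσ hφ ht₁, velocity_apply_one_of_fixed hσ hφ ht₂]
      ring
    · rw [not_or] at hno
      -- A free orbit on the axis is already a double point; a further point makes it triple.
      refine h3 t₂ (σ t₂) t₁ (Ne.symm ht₂) (Ne.symm hno.1) (Ne.symm hno.2) ?_ he.symm
      exact (map_eq_of_mem_axis hφ hax₂).symm
    · rw [disjoint_image_image_iff]
      intro t ht s hs he
      have hax : φ t ∈ axis := he ▸ map_mem_axis_of_fixed hφ hs
      refine h3 t (σ t) s (Ne.symm ht) ?_ ?_ (map_eq_of_mem_axis hφ hax).symm he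
      · rintro rfl
        exact ht hs
      · intro h0
        have : t = s := by rw [← hσ.involutive t, h0, hs]
        exact ht (this ▸ hs)

end Equivariant

end InvolutiveDiagram

/-! ### The smooth topology and openness -/

namespace InvolutiveDiagram

open Set Filter Topology

variable {ι : Type*}

theorem continuous_angularDeriv_uniformFun (k : ℕ) :
    Continuous fun φ : SmoothMap ι => UniformFun.ofFun (angularDeriv k φ) :=
  continuous_iff_le_induced.2 (iInf_le _ k)

/-- Uniform convergence to a continuous limit permits moving the point along with the map. -/
theorem continuous_angularDeriv_prod (k : ℕ) :
    Continuous fun p : SmoothMap ι × Circles ι => angularDeriv k p.1 p.2 := by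
  rw [continuous_iff_continuousAt]
  rintro ⟨φ, t⟩
  have h1 : TendstoUniformly (fun (p : SmoothMap ι × Circles ι) => angularDeriv k p.1)
      (angularDeriv k φ) (𝓝 (φ, t)) := by
    have := ((continuous_angularDeriv_uniformFun (ι := ι) k).comp continuous_fst).tendsto (φ, t)
    exact UniformFun.tendsto_iff_tendstoUniformly.1 this
  exact h1.tendsto_comp (φ.continuous_angularDeriv k).continuousAt continuous_snd.continuousAt

theorem continuous_velocity_prod :
    Continuous fun p : SmoothMap ι × Circles ι => velocity p.1 p.2 :=
  continuous_angularDeriv_prod 1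

theorem continuous_eval_prod :
    Continuous fun p : SmoothMap ι × Circles ι => p.1 p.2 := by
  simpa only [angularDeriv_zero] using continuous_angularDeriv_prod (ι := ι) 0

/-- Maps `C¹`-close to one with nonzero velocity at `t` are injective near `t`. -/
theorem SmoothMap.eventually_ne_of_velocity_ne_zero {φ : SmoothMap ι} {t : Circles ι}
    (ht : velocity φ t ≠ 0) :
    ∀ᶠ p : SmoothMap ι × Circles ι × Circles ι in 𝓝 (φ, t, t),
      p.2.1 ≠ p.2.2 → p.1 p.2.1 ≠ p.1 p.2.2 := by
  obtain ⟨k, hk⟩ : ∃ k, velocity φ t k ≠ 0 := by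
    by_contra! h
    exact ht (plane_ext (h 0) (h 1))
  obtain ⟨i, θ₀, rfl⟩ := exists_pt_eq t
  have hcont : Continuous fun q : SmoothMap ι × ℝ => velocity q.1 (pt i q.2) k := by
    have h1 : Continuous fun q : SmoothMap ι × ℝ => (q.1, pt i q.2) :=
      continuous_fst.prodMk ((continuous_pt i).comp continuous_snd)
    exact (EuclideanSpace.proj k : Plane →L[ℝ] ℝ).continuous.comp
      (continuous_velocity_prod.comp h1)
  have hne : ∀ᶠ q : SmoothMap ι × ℝ in 𝓝 (φ, θ₀), velocity q.1 (pt i q.2) k ≠ 0 :=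
    hcont.continuousAt.eventually_ne hk
  rw [nhds_prod_eq] at hne
  obtain ⟨P, hP, Q, hQ, hPQ⟩ := eventually_prod_iff.1 hne
  obtain ⟨r, hr, hrQ⟩ := Metric.eventually_nhds_iff_ball.1 hQ
  have harc : pt i '' Metric.ball θ₀ r ∈ 𝓝 (pt i θ₀) := by
    rw [nhds_pt]
    exact image_mem_map (Metric.ball_mem_nhds _ hr)
  have hmem : ∀ᶠ p : SmoothMap ι × Circles ι × Circles ι in 𝓝 (φ, pt i θ₀, pt i θ₀),
      P p.1 ∧ p.2.1 ∈ pt i '' Metric.ball θ₀ r ∧ p.2.2 ∈ pt i '' Metric.ball θ₀ r := by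
    rw [nhds_prod_eq, nhds_prod_eq]
    exact hP.prod_mk (Eventually.prod_mk harc harc)
  filter_upwards [hmem]
  rintro ⟨ψ, t₁, t₂⟩ ⟨hψ, ⟨θ₁, hθ₁, rfl⟩, ⟨θ₂, hθ₂, rfl⟩⟩ hne he
  -- Rolle: equal values of coordinate k would give a zero of its derivative inside the interval.
  have key : ∀ a b, a ∈ Metric.ball θ₀ r → b ∈ Metric.ball θ₀ r → a < b →
      ψ (pt i a) k ≠ ψ (pt i b) k := by
    intro a b ha hb hab hE
    have hd : ∀ x, HasDerivAt (fun s => ψ (pt i s) k) (velocity ψ (pt i x) k) x := fun x =>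
      (EuclideanSpace.proj k : Plane →L[ℝ] ℝ).hasFDerivAt.comp_hasDerivAt x (ψ.hasDerivAt_pt i x)
    obtain ⟨c, hc, hc0⟩ := exists_hasDerivAt_eq_zero hab
      (fun x _ => (hd x).continuousAt.continuousWithinAt) hE fun x _ => hd x
    have hcb : c ∈ Metric.ball θ₀ r := by
      rw [Real.ball_eq_Ioo] at *
      exact ⟨ha.1.trans hc.1, hc.2.trans hb.2⟩
    exact hPQ hψ (hrQ c hcb) hc0
  have he' : ψ (pt i θ₁) k = ψ (pt i θ₂) k := congrArg (fun v : Plane => v k) he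
  rcases lt_trichotomy θ₁ θ₂ with h | h | h
  · exact key _ _ hθ₁ hθ₂ h he'
  · exact hne (by rw [h])
  · exact key _ _ hθ₂ hθ₁ h he'.symm

/-- By compactness each condition need only persist near one tuple at a time. Tuples on a diagonal
use local injectivity, the others use continuity of values and determinants. -/
theorem SmoothMap.eventually_isRegular [Finite ι] {φ : SmoothMap ι} (hφ : IsRegular φ) :
    ∀ᶠ ψ : SmoothMap ι in 𝓝 φ, IsRegular ψ := by
  obtain ⟨h1, h2, h3⟩ := isRegular_iff.1 hφ
  have hev : ∀ {Z : Type _} [TopologicalSpace Z] {f g : Z → Circles ι}, Continuous f →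
      Continuous g → ∀ z, φ (f z) ≠ φ (g z) →
      ∀ᶠ p : SmoothMap ι × Z in 𝓝 (φ, z), p.1 (f p.2) ≠ p.1 (g p.2) := by
    intro Z _ f g hf hg z hz
    have hf' : Continuous fun p : SmoothMap ι × Z => p.1 (f p.2) :=
      continuous_eval_prod.comp (continuous_fst.prodMk (hf.comp continuous_snd))
    have hg' : Continuous fun p : SmoothMap ι × Z => p.1 (g p.2) :=
      continuous_eval_prod.comp (continuous_fst.prodMk (hg.comp continuous_snd))
    exact (isOpen_ne_fun hf' hg').mem_nhds hz
  have hdiag : ∀ {Z : Type _} [TopologicalSpace Z] {f g : Z → Circles ι}, Continuous f →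
      Continuous g → ∀ z, f z = g z → ∀ᶠ p : SmoothMap ι × Z in 𝓝 (φ, z),
        f p.2 ≠ g p.2 → p.1 (f p.2) ≠ p.1 (g p.2) := by
    intro Z _ f g hf hg z hz
    have hc : Continuous fun p : SmoothMap ι × Z => (p.1, f p.2, g p.2) :=
      continuous_fst.prodMk ((hf.comp continuous_snd).prodMk (hg.comp continuous_snd))
    have h4 := SmoothMap.eventually_ne_of_velocity_ne_zero (h1 (f z))
    exact (hc.tendsto' (φ, z) (φ, f z, f z) (by simp [hz])).eventually h4
  have e1 : ∀ᶠ ψ : SmoothMap ι in 𝓝 φ, ∀ t ∈ (univ : Set (Circles ι)), velocity ψ t ≠ 0 :=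
    isCompact_univ.eventually_forall_of_forall_eventually fun t _ =>
      continuous_velocity_prod.continuousAt.eventually_ne (h1 t)
  have e2 : ∀ᶠ ψ : SmoothMap ι in 𝓝 φ, ∀ s ∈ (univ : Set (Circles ι × Circles ι)),
      s.1 ≠ s.2 → ψ s.1 = ψ s.2 → LinearIndependent ℝ ![velocity ψ s.1, velocity ψ s.2] := by
    refine isCompact_univ.eventually_forall_of_forall_eventually fun s _ => ?_
    by_cases hs : s.1 = s.2
    · filter_upwards [hdiag continuous_fst continuous_snd s hs] with p hp hne he
      exact absurd he (hp hne)
    by_cases hv : φ s.1 = φ s.2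
    · have h5 := h2 s.1 s.2 hs hv
      have hc1 : Continuous fun p : SmoothMap ι × Circles ι × Circles ι => velocity p.1 p.2.1 :=
        continuous_velocity_prod.comp (continuous_fst.prodMk (continuous_fst.comp continuous_snd))
      have hc2 : Continuous fun p : SmoothMap ι × Circles ι × Circles ι => velocity p.1 p.2.2 :=
        continuous_velocity_prod.comp (continuous_fst.prodMk (continuous_snd.comp continuous_snd))
      have hcoord : ∀ k, Continuous fun w : Plane => w k := fun k =>
        (EuclideanSpace.proj k : Plane →L[ℝ] ℝ).continuous
      rw [linearIndependent_plane_iff] at h5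
      have hc := (((hcoord 0).comp hc1).mul ((hcoord 1).comp hc2)).sub
        (((hcoord 1).comp hc1).mul ((hcoord 0).comp hc2))
      filter_upwards [(hc.continuousAt (x := (φ, s))).eventually_ne h5] with p hp _ _
      exact linearIndependent_plane_iff.2 hp
    · filter_upwards [hev continuous_fst continuous_snd s hv] with p hp _ he
      exact absurd he hp
  have e3 : ∀ᶠ ψ : SmoothMap ι in 𝓝 φ, ∀ s ∈ (univ : Set (Circles ι × Circles ι × Circles ι)),
      s.1 ≠ s.2.1 → s.1 ≠ s.2.2 → s.2.1 ≠ s.2.2 → ψ s.1 = ψ s.2.1 → ψ s.1 ≠ ψ s.2.2 := by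
    refine isCompact_univ.eventually_forall_of_forall_eventually fun s _ => ?_
    have c2 : Continuous fun s : Circles ι × Circles ι × Circles ι => s.2.1 :=
      continuous_fst.comp continuous_snd
    have c3 : Continuous fun s : Circles ι × Circles ι × Circles ι => s.2.2 :=
      continuous_snd.comp continuous_snd
    by_cases h12 : s.1 = s.2.1
    · filter_upwards [hdiag continuous_fst c2 s h12] with p hp h _ _ he
      exact absurd he (hp h)
    by_cases h13 : s.1 = s.2.2
    · filter_upwards [hdiag continuous_fst c3 s h13] with p hp _ h _ _
      exact hp h
    by_cases h23 : s.2.1 = s.2.2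
    · filter_upwards [hdiag c2 c3 s h23] with p hp _ _ h he
      exact he ▸ hp h
    by_cases hv : φ s.1 = φ s.2.1
    · filter_upwards [hev continuous_fst c3 s (h3 _ _ _ h12 h13 h23 hv)] with p hp _ _ _ _
      exact hp
    · filter_upwards [hev continuous_fst c2 s hv] with p hp _ _ _ he
      exact absurd he hp
  filter_upwards [e1, e2, e3] with ψ g1 g2 g3
  exact isRegular_iff.2 ⟨fun t => g1 t (mem_univ _),
    fun t₁ t₂ => g2 (t₁, t₂) (mem_univ _), fun t₁ t₂ t₃ => g3 (t₁, t₂, t₃) (mem_univ _)⟩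

theorem isOpen_equivariantRegularMaps [Finite ι] {σ : Circles ι → Circles ι}
    (hσ : IsSmoothInvolution σ) :
    IsOpen {φ : equivariantMaps σ | (φ : SmoothMap ι) ∈ equivariantRegularMaps σ} := by
  rw [isOpen_iff_mem_nhds]
  intro φ hφ
  have h1 := SmoothMap.eventually_isRegular ((mem_equivariantRegularMaps_iff hσ φ.2.1).1 hφ)
  filter_upwards [continuous_subtype_val.continuousAt.eventually h1] with ψ hψ
  exact (mem_equivariantRegularMaps_iff hσ ψ.2.1).2 hψ

end InvolutiveDiagram

/-! ### Equivariant polynomial perturbations -/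

namespace InvolutiveDiagram

open Set Filter Topology

open scoped Polynomial

variable {ι : Type*}

/-- Coefficients of a family of complex polynomials of degree less than `12`, one for each
circle. -/
abbrev Coeffs (ι : Type*) : Type _ := ι → Fin 12 → ℂ

/-- The polynomial on the `j`-th circle with the given coefficients. -/
def poly (a : Coeffs ι) (j : ι) : ℂ[X] :=
  ∑ k : Fin 12, Polynomial.C (a j k) * Polynomial.X ^ (k : ℕ)

/-- Hermite interpolation: Q vanishes doubly at the points of Z on the circle of t but not at t, and
a linear factor adjusts the jet at t. Five points give degree at most 2 · 5 + 1 = 11, whence the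
bound 12. -/
theorem exists_poly_jet (t : Circles ι) (Z : Finset (Circles ι)) (hcard : Z.card ≤ 5)
    (ht : t ∉ Z) (v w : ℂ) :
    ∃ a : Coeffs ι, (poly a t.1).eval (t.2 : ℂ) = v ∧
      (Polynomial.derivative (poly a t.1)).eval (t.2 : ℂ) = w ∧
      ∀ z ∈ Z, (poly a z.1).eval (z.2 : ℂ) = 0 ∧
        (Polynomial.derivative (poly a z.1)).eval (z.2 : ℂ) = 0 := by
  classical
  set Q : ℂ[X] := ∏ z ∈ Z with z.1 = t.1, (Polynomial.X - Polynomial.C (z.2 : ℂ)) ^ 2 with hQ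
  set q₀ : ℂ := Q.eval (t.2 : ℂ) with hq₀
  have hne : q₀ ≠ 0 := by
    rw [hq₀, hQ, Polynomial.eval_prod, Finset.prod_ne_zero_iff]
    intro z hz
    rw [Finset.mem_filter] at hz
    simp only [Polynomial.eval_pow, Polynomial.eval_sub, Polynomial.eval_X, Polynomial.eval_C]
    refine pow_ne_zero 2 (sub_ne_zero.2 fun h => ht ?_)
    have : t = z := Sigma.ext hz.2.symm (heq_of_eq (Circle.ext h))
    exact this ▸ hz.1
  -- The triangular system Q(t)α = v, Q'(t)α + Q(t)β = w.
  set α : ℂ := v / q₀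
  set β : ℂ := (w - (Polynomial.derivative Q).eval (t.2 : ℂ) * α) / q₀
  set q : ℂ[X] := Q * (Polynomial.C α + Polynomial.C β * (Polynomial.X - Polynomial.C (t.2 : ℂ)))
    with hq
  have hdegQ : Q.natDegree ≤ 10 := by
    refine (Polynomial.natDegree_prod_le _ _).trans ?_
    refine (Finset.sum_le_card_nsmul _ _ 2 fun z _ => ?_).trans ?_
    · refine Polynomial.natDegree_pow_le.trans ?_
      rw [Polynomial.natDegree_X_sub_C]
    · have := Finset.card_filter_le Z fun z => z.1 = t.1
      rw [smul_eq_mul]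
      omega
  have hdeg : q.natDegree < 12 := by
    have h1 : (Polynomial.C α + Polynomial.C β *
        (Polynomial.X - Polynomial.C (t.2 : ℂ))).natDegree ≤ 1 := by
      refine Polynomial.natDegree_add_le_of_degree_le (by simp) ?_
      refine (Polynomial.natDegree_C_mul_le _ _).trans ?_
      rw [Polynomial.natDegree_X_sub_C]
    have := Polynomial.natDegree_mul_le (p := Q)
      (q := Polynomial.C α + Polynomial.C β * (Polynomial.X - Polynomial.C (t.2 : ℂ)))
    rw [← hq] at this
    omega
  have hpoly : ∀ j, poly (fun j (k : Fin 12) => if j = t.1 then q.coeff k else 0 : Coeffs ι) j =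
      if j = t.1 then q else 0 := by
    intro j
    by_cases hj : j = t.1
    · simp only [poly, hj, if_true]
      rw [Fin.sum_univ_eq_sum_range (fun k => Polynomial.C (q.coeff k) * Polynomial.X ^ k) 12]
      exact (Polynomial.as_sum_range_C_mul_X_pow' q hdeg).symm
    · simp [poly, hj]
  refine ⟨fun j k => if j = t.1 then q.coeff k else 0, ?_, ?_, fun z hz => ?_⟩
  · rw [hpoly, if_pos rfl, hq]
    simp only [Polynomial.eval_mul, Polynomial.eval_add, Polynomial.eval_C, Polynomial.eval_sub,
      Polynomial.eval_X, sub_self, mul_zero, add_zero]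
    exact mul_div_cancel₀ _ hne
  · rw [hpoly, if_pos rfl, hq]
    simp only [Polynomial.derivative_mul, Polynomial.eval_mul, Polynomial.eval_add,
      Polynomial.eval_C, Polynomial.eval_sub, Polynomial.derivative_add, Polynomial.derivative_C,
      Polynomial.derivative_sub, Polynomial.derivative_X,
      Polynomial.eval_X, sub_self, mul_zero, add_zero, zero_mul, zero_add, sub_zero, mul_one]
    rw [← hq₀, mul_div_cancel₀ _ hne]
    ring
  · rw [hpoly]
    split_ifs with hz1
    · obtain ⟨r, hr⟩ : (Polynomial.X - Polynomial.C (z.2 : ℂ)) ^ 2 ∣ q :=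
        (Finset.dvd_prod_of_mem (fun z : Circles ι => (Polynomial.X - Polynomial.C (z.2 : ℂ)) ^ 2)
          (Finset.mem_filter.2 ⟨hz, hz1⟩)).mul_right _
      rw [hr]
      simp [Polynomial.derivative_mul, Polynomial.derivative_pow]
    · simp

/-- Evaluation at `w` of the polynomial on the `j`-th circle. -/
def polyEval (j : ι) (w : ℂ) : Coeffs ι →L[ℝ] ℂ :=
  ∑ k : Fin 12, (ContinuousLinearMap.mul ℝ ℂ (w ^ (k : ℕ))).comp
    ((ContinuousLinearMap.proj k : (Fin 12 → ℂ) →L[ℝ] ℂ).comp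
      (ContinuousLinearMap.proj j : Coeffs ι →L[ℝ] (Fin 12 → ℂ)))

theorem polyEval_apply (j : ι) (w : ℂ) (a : Coeffs ι) : polyEval j w a = (poly a j).eval w := by
  simp only [polyEval, poly, Polynomial.eval_finsetSum, sum_apply,
    ContinuousLinearMap.comp_apply, ContinuousLinearMap.proj_apply, ContinuousLinearMap.mul_apply',
    Polynomial.eval_mul, Polynomial.eval_C, Polynomial.eval_pow, Polynomial.eval_X]
  exact Finset.sum_congr rfl fun k _ => mul_comm _ _

theorem contDiff_polyEval [Fintype ι] (j : ι) : ContDiff ℝ ∞ (polyEval j) := by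
  refine ContDiff.sum fun k _ => ?_
  refine ContDiff.clm_comp ?_ contDiff_const
  exact (ContinuousLinearMap.mul ℝ ℂ).contDiff.comp (contDiff_id.pow _)

/-- The identification of the complex numbers with the plane. -/
def complexPlane : ℂ ≃L[ℝ] Plane :=
  Complex.orthonormalBasisOneI.repr.toContinuousLinearEquiv

/-- The equivariant perturbation with given coefficients, evaluated at a point. -/
def perturb (σ : Circles ι → Circles ι) (t : Circles ι) : Coeffs ι →L[ℝ] Plane :=
  (complexPlane : ℂ →L[ℝ] Plane).comp (polyEval t.1 t.2) +
    (reflectionCLM.comp (complexPlane : ℂ →L[ℝ] Plane)).comp (polyEval (σ t).1 (σ t).2)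

theorem perturb_apply (σ : Circles ι → Circles ι) (t : Circles ι) (a : Coeffs ι) :
    perturb σ t a = complexPlane ((poly a t.1).eval (t.2 : ℂ)) +
      reflection (complexPlane ((poly a (σ t).1).eval ((σ t).2 : ℂ))) := by
  simp [perturb, polyEval_apply]

theorem reflection_reflection (w : Plane) : reflection (reflection w) = w :=
  plane_ext (by simp) (by simp)

theorem reflection_add (v w : Plane) : reflection (v + w) = reflection v + reflection w :=
  reflectionCLM.map_add v w

variable {σ : Circles ι → Circles ι}

theorem perturb_involution (hσ : IsSmoothInvolution σ) (t : Circles ι) (a : Coeffs ι) :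
    perturb σ (σ t) a = reflection (perturb σ t a) := by
  rw [perturb_apply, perturb_apply, hσ.involutive, reflection_add, reflection_reflection, add_comm]

theorem contMDiff_perturb [Fintype ι] (hσ : IsSmoothInvolution σ) (i : ι) :
    ContMDiff (𝓡 1) 𝓘(ℝ, Coeffs ι →L[ℝ] Plane) ∞ (fun z : Circle => perturb σ ⟨i, z⟩) := by
  have : Fact (Module.finrank ℝ ℂ = 1 + 1) := finrank_real_complex_fact'
  have hcoe : ContMDiff (𝓡 1) 𝓘(ℝ, ℂ) ∞ (fun z : Circle => (z : ℂ)) :=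
    contMDiff_coe_sphere
  -- The circle containing σ(t) is constant along circle i, so one formula serves the whole circle.
  set j := (σ (pt i 0)).1
  have hG : ContDiff ℝ ∞ (fun w : ℂ × ℂ =>
      (complexPlane : ℂ →L[ℝ] Plane).comp (polyEval i w.1) +
        (reflectionCLM.comp (complexPlane : ℂ →L[ℝ] Plane)).comp (polyEval j w.2)) := by
    refine ContDiff.add ?_ ?_
    · exact contDiff_const.clm_comp ((contDiff_polyEval i).comp contDiff_fst)
    · exact contDiff_const.clm_comp ((contDiff_polyEval j).comp contDiff_snd)
  have h := hG.contMDiff.comp (hcoe.prodMk_space (hcoe.comp (hσ.smooth i)))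
  refine h.congr fun z => ?_
  have hj : (σ ⟨i, z⟩).1 = j := by
    have := hσ.fst_eq i (Complex.arg z)
    rwa [pt, Circle.exp_arg] at this
  simp only [perturb, Function.comp, hj]

theorem contDiff_perturb_pt [Fintype ι] (hσ : IsSmoothInvolution σ) (i : ι) :
    ContDiff ℝ ∞ (fun θ => perturb σ (pt i θ)) :=
  ((contMDiff_perturb hσ i).comp contMDiff_circleExp).contDiff

end InvolutiveDiagram

/-! ### Prescribing jets of perturbations -/

namespace InvolutiveDiagram

open Set Filter Topology

variable {ι : Type*} [Fintype ι] {σ : Circles ι → Circles ι}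

/-- The angular derivative of the equivariant perturbation. -/
def perturbDeriv (σ : Circles ι → Circles ι) (i : ι) (θ : ℝ) : Coeffs ι →L[ℝ] Plane :=
  deriv (fun s => perturb σ (pt i s)) θ

theorem hasDerivAt_perturb (hσ : IsSmoothInvolution σ) (i : ι) (θ : ℝ) :
    HasDerivAt (fun s => perturb σ (pt i s)) (perturbDeriv σ i θ) θ :=
  (((contDiff_perturb_pt hσ i).differentiable (by simp)) θ).hasDerivAt

theorem hasDerivAt_perturb_apply (hσ : IsSmoothInvolution σ) (i : ι) (θ : ℝ) (a : Coeffs ι) :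
    HasDerivAt (fun s => perturb σ (pt i s) a) (perturbDeriv σ i θ a) θ :=
  (ContinuousLinearMap.apply ℝ Plane a).hasFDerivAt.comp_hasDerivAt θ (hasDerivAt_perturb hσ i θ)

theorem contDiff_perturbDeriv (hσ : IsSmoothInvolution σ) (i : ι) :
    ContDiff ℝ 1 (perturbDeriv σ i) := by
  have h := contDiff_perturb_pt hσ i
  exact (contDiff_infty_iff_deriv.1 h).2.of_le (by exact_mod_cast le_top)

/-- The velocity of the polynomial curve on the `j`-th circle. -/
def polyVelocity (a : Coeffs ι) (t : Circles ι) : Plane :=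
  complexPlane (Complex.I * t.2 * (Polynomial.derivative (poly a t.1)).eval (t.2 : ℂ))

omit [Fintype ι] in
theorem hasDerivAt_poly_pt (a : Coeffs ι) (j : ι) (θ : ℝ) :
    HasDerivAt (fun s => complexPlane ((poly a j).eval ((pt j s).2 : ℂ)))
      (polyVelocity a (pt j θ)) θ := by
  have h1 : HasDerivAt (fun s : ℝ => ((Circle.exp s : Circle) : ℂ))
      (Complex.I * (Circle.exp θ : ℂ)) θ := by
    simp only [Circle.coe_exp]
    have h2 : HasDerivAt (fun s : ℝ => (s : ℂ) * Complex.I) Complex.I θ := by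
      simpa using (Complex.ofRealCLM.hasDerivAt (x := θ)).mul_const Complex.I
    simpa [mul_comm] using h2.cexp
  have h3 := ((poly a j).hasDerivAt (Circle.exp θ : ℂ)).comp θ h1
  have h4 := (complexPlane : ℂ →L[ℝ] Plane).hasFDerivAt.comp_hasDerivAt θ h3
  rw [mul_comm] at h4
  exact h4

theorem perturbDeriv_apply (hσ : IsSmoothInvolution σ) {i j : ι} {θ d : ℝ} {H : ℝ → ℝ}
    (hH : HasDerivAt H d θ) (hσH : ∀ s, σ (pt i s) = pt j (H s)) (a : Coeffs ι) :
    perturbDeriv σ i θ a =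
      polyVelocity a (pt i θ) + d • reflection (polyVelocity a (σ (pt i θ))) := by
  have h1 := hasDerivAt_poly_pt a i θ
  have h2 := (reflectionCLM.hasFDerivAt.comp_hasDerivAt (H θ) (hasDerivAt_poly_pt a j (H θ))).scomp
    θ hH
  rw [hσH]
  refine (hasDerivAt_perturb_apply hσ i θ a).unique ((h1.add h2).congr_of_eventuallyEq
    (Eventually.of_forall fun s => ?_))
  simp only [perturb_apply, hσH]
  rfl

/-- Vanishing of the first jet of the polynomials at a point. -/
def JetVanishes (a : Coeffs ι) (t : Circles ι) : Prop :=
  (poly a t.1).eval (t.2 : ℂ) = 0 ∧ (Polynomial.derivative (poly a t.1)).eval (t.2 : ℂ) = 0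

omit [Fintype ι] in
theorem JetVanishes.polyVelocity_eq_zero {a : Coeffs ι} {t : Circles ι} (h : JetVanishes a t) :
    polyVelocity a t = 0 := by
  rw [polyVelocity, h.2, mul_zero, map_zero]

theorem reflection_zero : reflection 0 = 0 := reflectionCLM.map_zero

omit [Fintype ι] in
theorem perturb_of_jetVanishes {a : Coeffs ι} {t : Circles ι} (h : JetVanishes a (σ t)) :
    perturb σ t a = complexPlane ((poly a t.1).eval (t.2 : ℂ)) := by
  rw [perturb_apply, h.1, map_zero, reflection_zero, add_zero]

/-- The reflected summand depends only on the jet at σ(t); killing it leaves the polynomial alone.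
-/
theorem perturbDeriv_of_jetVanishes (hσ : IsSmoothInvolution σ) {a : Coeffs ι} {i : ι} {θ : ℝ}
    (h : JetVanishes a (σ (pt i θ))) :
    perturbDeriv σ i θ a = polyVelocity a (pt i θ) := by
  obtain ⟨j, θ₁, h1⟩ := exists_pt_eq (σ (pt i θ))
  obtain ⟨H, hH, -, hσH⟩ := hσ.exists_lift h1.symm
  rw [perturbDeriv_apply hσ (hH.differentiableAt (by simp)).hasDerivAt hσH,
    h.polyVelocity_eq_zero, reflection_zero, smul_zero, add_zero]

/-- At a free point the first jet of an equivariant perturbation can be prescribed, with vanishing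
jets at points of at most two other orbits. -/
theorem exists_perturb_jet_of_finset (hσ : IsSmoothInvolution σ) {i : ι} {θ : ℝ}
    (hfree : σ (pt i θ) ≠ pt i θ) (T : Finset (Circles ι)) (hT : T.card ≤ 2)
    (hTne : ∀ s ∈ T, s ≠ pt i θ ∧ s ≠ σ (pt i θ)) (v w : Plane) :
    ∃ a : Coeffs ι, perturb σ (pt i θ) a = v ∧ perturbDeriv σ i θ a = w ∧
      ∀ j θ', pt j θ' ∈ T → perturb σ (pt j θ') a = 0 ∧ perturbDeriv σ j θ' a = 0 := by
  classical
  have hz : Complex.I * ((pt i θ).2 : ℂ) ≠ 0 := mul_ne_zero Complex.I_ne_zero (Circle.coe_ne_zero _)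
  -- The mirror point of t, at most two further points, and their mirror points.
  have hcard : (insert (σ (pt i θ)) (T ∪ T.image σ)).card ≤ 5 := by
    have h1 := Finset.card_insert_le (σ (pt i θ)) (T ∪ T.image σ)
    have h2 := Finset.card_union_le T (T.image σ)
    have h3 := Finset.card_image_le (s := T) (f := σ)
    omega
  have hmem : pt i θ ∉ insert (σ (pt i θ)) (T ∪ T.image σ) := by
    simp only [Finset.mem_insert, Finset.mem_union, Finset.mem_image, not_or, not_exists, not_and]
    refine ⟨hfree.symm, fun h => (hTne _ h).1 rfl, fun s hs h => (hTne s hs).2 ?_⟩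
    rw [← h, hσ.involutive]
  obtain ⟨a, hv, hw, hJ⟩ := exists_poly_jet (pt i θ) _ hcard hmem
    (complexPlane.symm v) (complexPlane.symm w / (Complex.I * ((pt i θ).2 : ℂ)))
  have e : JetVanishes a (σ (pt i θ)) := hJ _ (by simp)
  refine ⟨a, ?_, ?_, fun j θ' hj => ?_⟩
  · rw [perturb_of_jetVanishes e, hv, complexPlane.apply_symm_apply]
  · rw [perturbDeriv_of_jetVanishes hσ e, polyVelocity, hw, mul_div_cancel₀ _ hz,
      complexPlane.apply_symm_apply]
  · have e1 : JetVanishes a (pt j θ') := hJ _ (by simp [hj])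
    have e2 : JetVanishes a (σ (pt j θ')) :=
      hJ _ (Finset.mem_insert_of_mem (Finset.mem_union_right _ (Finset.mem_image_of_mem σ hj)))
    rw [perturb_of_jetVanishes e2, e1.1, map_zero, perturbDeriv_of_jetVanishes hσ e2,
      e1.polyVelocity_eq_zero]
    exact ⟨rfl, rfl⟩

theorem exists_perturb_jet (hσ : IsSmoothInvolution σ) {i : ι} {θ : ℝ}
    (hfree : σ (pt i θ) ≠ pt i θ) (v w : Plane) :
    ∃ a : Coeffs ι, perturb σ (pt i θ) a = v ∧ perturbDeriv σ i θ a = w := by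
  obtain ⟨a, hv, hw, -⟩ := exists_perturb_jet_of_finset hσ hfree ∅ (by simp) (by simp) v w
  exact ⟨a, hv, hw⟩

theorem exists_perturb_jet_pair (hσ : IsSmoothInvolution σ) {i j : ι} {θ θ₂ : ℝ}
    (hfree : σ (pt i θ) ≠ pt i θ) (h₂ : pt j θ₂ ≠ pt i θ) (h₂' : pt j θ₂ ≠ σ (pt i θ))
    (v w : Plane) :
    ∃ a : Coeffs ι, perturb σ (pt i θ) a = v ∧ perturbDeriv σ i θ a = w ∧
      perturb σ (pt j θ₂) a = 0 ∧ perturbDeriv σ j θ₂ a = 0 := by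
  obtain ⟨a, hv, hw, h⟩ := exists_perturb_jet_of_finset hσ hfree {pt j θ₂} (by simp)
    (by simp [h₂, h₂']) v w
  exact ⟨a, hv, hw, h j θ₂ (by simp)⟩

theorem exists_perturb_jet_triple (hσ : IsSmoothInvolution σ) {i j k : ι} {θ θ₂ θ₃ : ℝ}
    (hfree : σ (pt i θ) ≠ pt i θ) (h₂ : pt j θ₂ ≠ pt i θ) (h₂' : pt j θ₂ ≠ σ (pt i θ))
    (h₃ : pt k θ₃ ≠ pt i θ) (h₃' : pt k θ₃ ≠ σ (pt i θ)) (v : Plane) :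
    ∃ a : Coeffs ι, perturb σ (pt i θ) a = v ∧ perturb σ (pt j θ₂) a = 0 ∧
      perturb σ (pt k θ₃) a = 0 := by
  classical
  obtain ⟨a, hv, -, h⟩ := exists_perturb_jet_of_finset hσ hfree {pt j θ₂, pt k θ₃}
    Finset.card_le_two (by simp [h₂, h₂', h₃, h₃']) v 0
  exact ⟨a, hv, (h j θ₂ (by simp)).1, (h k θ₃ (by simp)).1⟩

-- At a fixed point the value is p + τ(p), so only the second coordinate can move, and it is
-- doubled; hence r / 2.
omit [Fintype ι] in
theorem exists_perturb_of_fixed {s t : Circles ι} (hs : σ s = s)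
    (ht : σ t = t) (hst : s ≠ t) (r : ℝ) :
    ∃ a : Coeffs ι, perturb σ s a 1 = r ∧ perturb σ t a = 0 := by
  classical
  obtain ⟨a, hv, -, hZ⟩ := exists_poly_jet s {t} (by simp) (by simpa using hst)
    (complexPlane.symm !₂[0, r / 2]) 0
  have e : JetVanishes a t := hZ t (by simp)
  refine ⟨a, ?_, ?_⟩
  · rw [perturb_apply, hs, hv, complexPlane.apply_symm_apply]
    simp
  · rw [perturb_of_jetVanishes (ht.symm ▸ e), e.1, map_zero]

/-- Since the lift has derivative -1, the derivative is v - τ(v): only the first coordinate can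
move, and it is doubled. -/
theorem exists_perturbDeriv_of_fixed (hσ : IsSmoothInvolution σ) {i : ι} {θ : ℝ}
    (hs : σ (pt i θ) = pt i θ) (r : ℝ) :
    ∃ a : Coeffs ι, perturbDeriv σ i θ a 0 = r := by
  have hz : Complex.I * ((pt i θ).2 : ℂ) ≠ 0 := mul_ne_zero Complex.I_ne_zero (Circle.coe_ne_zero _)
  obtain ⟨a, -, hw, -⟩ := exists_poly_jet (pt i θ) ∅ (by simp) (by simp) 0
    (complexPlane.symm !₂[r / 2, 0] / (Complex.I * ((pt i θ).2 : ℂ)))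
  obtain ⟨H, hH, -, hσH⟩ := hσ.exists_lift_of_fixed hs
  refine ⟨a, ?_⟩
  rw [perturbDeriv_apply hσ hH hσH, hs, polyVelocity, hw, mul_div_cancel₀ _ hz,
    complexPlane.apply_symm_apply]
  simp

/-- The sum of a smooth map and an equivariant perturbation. -/
def SmoothMap.addPerturb (φ : SmoothMap ι) (hσ : IsSmoothInvolution σ) (a : Coeffs ι) :
    SmoothMap ι where
  toFun t := φ t + perturb σ t a
  smooth i := by
    refine (φ.smooth i).add ?_
    exact (ContinuousLinearMap.apply ℝ Plane a).contDiff.contMDiff.comp (contMDiff_perturb hσ i)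

theorem SmoothMap.addPerturb_apply (φ : SmoothMap ι) (hσ : IsSmoothInvolution σ) (a : Coeffs ι)
    (t : Circles ι) : φ.addPerturb hσ a t = φ t + perturb σ t a := rfl

theorem SmoothMap.velocity_addPerturb (φ : SmoothMap ι) (hσ : IsSmoothInvolution σ) (a : Coeffs ι)
    (i : ι) (θ : ℝ) :
    velocity (φ.addPerturb hσ a) (pt i θ) = velocity φ (pt i θ) + perturbDeriv σ i θ a :=
  ((φ.addPerturb hσ a).hasDerivAt_pt i θ).unique
    ((φ.hasDerivAt_pt i θ).add (hasDerivAt_perturb_apply hσ i θ a))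

theorem SmoothMap.isEquivariant_addPerturb {φ : SmoothMap ι} (hφ : IsEquivariant σ φ)
    (hσ : IsSmoothInvolution σ) (a : Coeffs ι) : IsEquivariant σ (φ.addPerturb hσ a) := by
  intro t
  rw [φ.addPerturb_apply, φ.addPerturb_apply, hφ, perturb_involution hσ, reflection_add]

theorem iteratedDeriv_perturb_apply (hσ : IsSmoothInvolution σ) (k : ℕ) (i : ι) (θ : ℝ)
    (a : Coeffs ι) :
    iteratedDeriv k (fun s => perturb σ (pt i s) a) θ =
      iteratedDeriv k (fun s => perturb σ (pt i s)) θ a := by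
  induction k generalizing θ with
  | zero => simp
  | succ k ih =>
    rw [iteratedDeriv_succ, iteratedDeriv_succ, funext ih]
    have hd : DifferentiableAt ℝ (iteratedDeriv k fun s => perturb σ (pt i s)) θ :=
      ((contDiff_perturb_pt hσ i).differentiable_iteratedDeriv k
        (by exact_mod_cast WithTop.coe_lt_top _)) θ
    exact ((ContinuousLinearMap.apply ℝ Plane a).hasFDerivAt.comp_hasDerivAt θ
      hd.hasDerivAt).deriv

theorem SmoothMap.angularDeriv_addPerturb (φ : SmoothMap ι) (hσ : IsSmoothInvolution σ)
    (a : Coeffs ι) (k : ℕ) (i : ι) (θ : ℝ) :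
    angularDeriv k (φ.addPerturb hσ a) (pt i θ) =
      angularDeriv k φ (pt i θ) + iteratedDeriv k (fun s => perturb σ (pt i s)) θ a := by
  rw [angularDeriv_pt, angularDeriv_pt, ← iteratedDeriv_perturb_apply hσ]
  have hk : ((k : ℕ∞) : WithTop ℕ∞) ≤ ∞ := by exact_mod_cast le_top
  have h1 : ContDiffAt ℝ k (fun s => φ (pt i s)) θ :=
    ((φ.contDiff_pt i).of_le hk).contDiffAt
  have h2 : ContDiffAt ℝ k (fun s => perturb σ (pt i s) a) θ :=
    (((contDiff_perturb_pt hσ i).clm_apply contDiff_const).of_le hk).contDiffAt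
  exact iteratedDeriv_add h1 h2

/-- Each angular derivative is affine in a, and its linear part is bounded uniformly over the
finitely many compact circles. -/
theorem SmoothMap.continuous_addPerturb (φ : SmoothMap ι) (hσ : IsSmoothInvolution σ) :
    Continuous (φ.addPerturb hσ) := by
  refine continuous_iInf_rng.2 fun k => continuous_induced_rng.2 ?_
  obtain ⟨C, hC⟩ : ∃ C : ℝ, ∀ i, ∀ θ ∈ Icc (-Real.pi) Real.pi,
      ‖iteratedDeriv k (fun s => perturb σ (pt i s)) θ‖ ≤ C := by
    have h : ∀ i, ∃ C : ℝ, ∀ θ ∈ Icc (-Real.pi) Real.pi,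
        ‖iteratedDeriv k (fun s => perturb σ (pt i s)) θ‖ ≤ C := fun i =>
      isCompact_Icc.exists_bound_of_continuousOn
        ((contDiff_perturb_pt hσ i).continuous_iteratedDeriv k
          (by exact_mod_cast le_top)).continuousOn
    choose C hC using h
    exact ⟨∑ i, |C i|, fun i θ hθ => (hC i θ hθ).trans ((le_abs_self _).trans
      (Finset.single_le_sum (f := fun i => |C i|) (fun _ _ => abs_nonneg _) (Finset.mem_univ i)))⟩
  rw [continuous_iff_continuousAt]
  intro a
  refine UniformFun.tendsto_iff_tendstoUniformly.2 ?_
  rw [Metric.tendstoUniformly_iff]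
  intro ε hε
  have hsmall : ∀ᶠ b in 𝓝 a, |C| * ‖a - b‖ < ε := by
    have hc : Continuous fun b : Coeffs ι => |C| * ‖a - b‖ := by fun_prop
    exact (hc.tendsto' a 0 (by simp)).eventually_lt_const hε
  filter_upwards [hsmall] with b hb t
  obtain ⟨i, θ, hθ, rfl⟩ := exists_mem_Icc_pt_eq t
  refine lt_of_le_of_lt ?_ hb
  simp only [UniformFun.toFun_ofFun, Function.comp]
  rw [φ.angularDeriv_addPerturb, φ.angularDeriv_addPerturb, dist_add_left, dist_eq_norm, ← map_sub]
  exact (ContinuousLinearMap.le_opNorm _ _).trans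
    (mul_le_mul_of_nonneg_right ((hC i θ hθ).trans (le_abs_self _)) (norm_nonneg _))

end InvolutiveDiagram

/-! ### Generic regularity and density -/

namespace InvolutiveDiagram

open Set Filter Topology MeasureTheory Module

/-- The coordinate functionals of the plane. -/
abbrev coord (k : Fin 2) : Plane →L[ℝ] ℝ := EuclideanSpace.proj k

theorem finite_fixedPoints {ι : Type*} [Finite ι] {σ : Circles ι → Circles ι}
    (hσ : IsSmoothInvolution σ) : {t | σ t = t}.Finite := by
  have hcl : IsClosed {t | σ t = t} := isClosed_eq hσ.continuous continuous_id
  refine hcl.isCompact.finite (isDiscrete_iff_discreteTopology.2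
    (discreteTopology_subtype_iff.2 fun t ht => ?_))
  rw [inf_principal_eq_bot]
  exact hσ.isolated t ht

theorem SmoothMap.contDiff_one_pt {ι : Type*} (φ : SmoothMap ι) (i : ι) :
    ContDiff ℝ 1 (fun θ => φ (pt i θ)) :=
  (φ.contDiff_pt i).of_le (by exact_mod_cast le_top)

theorem SmoothMap.contDiff_one_velocity_pt {ι : Type*} (φ : SmoothMap ι) (i : ι) :
    ContDiff ℝ 1 (fun θ => velocity φ (pt i θ)) := by
  simp only [velocity_pt]
  exact (contDiff_infty_iff_deriv.1 (φ.contDiff_pt i)).2.of_le (by exact_mod_cast le_top)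

theorem contDiff_coord_comp {X : Type*} [NormedAddCommGroup X] [NormedSpace ℝ X] {f : X → Plane}
    (hf : ContDiff ℝ 1 f) (k : Fin 2) : ContDiff ℝ 1 (fun x => f x k) :=
  (coord k).contDiff.comp hf

theorem contDiff_clm_prod {X E F G : Type*} [NormedAddCommGroup X] [NormedSpace ℝ X]
    [NormedAddCommGroup E] [NormedSpace ℝ E] [NormedAddCommGroup F] [NormedSpace ℝ F]
    [NormedAddCommGroup G] [NormedSpace ℝ G] {f : X → E →L[ℝ] F} {g : X → E →L[ℝ] G}
    (hf : ContDiff ℝ 1 f) (hg : ContDiff ℝ 1 g) : ContDiff ℝ 1 fun x => (f x).prod (g x) :=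
  (ContinuousLinearMap.prodₗᵢ ℝ : (E →L[ℝ] F) × (E →L[ℝ] G) ≃ₗᵢ[ℝ] E →L[ℝ] F × G).contDiff.comp
    (hf.prodMk hg)

section Families

variable {ι : Type*} [Fintype ι] {σ : Circles ι → Circles ι}

theorem contDiff_one_perturb_pt (hσ : IsSmoothInvolution σ) (i : ι) :
    ContDiff ℝ 1 (fun θ => perturb σ (pt i θ)) :=
  (contDiff_perturb_pt hσ i).of_le (by exact_mod_cast le_top)

variable (φ : SmoothMap ι) (hσ : IsSmoothInvolution σ)

/-- A reference measure on the space of coefficients. -/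
abbrev coeffMeasure (ι : Type*) [Fintype ι] : Measure (Coeffs ι) := Measure.addHaar

theorem ae_velocity_ne_zero (i : ι) :
    ∀ᵐ a ∂coeffMeasure ι, ∀ θ, σ (pt i θ) ≠ pt i θ →
      velocity (φ.addPerturb hσ a) (pt i θ) ≠ 0 := by
  filter_upwards [ae_forall_affine_ne_zero (φ.contDiff_one_velocity_pt i)
    (contDiff_perturbDeriv hσ i) (by simp) (coeffMeasure ι)] with a ha θ hθ
  rw [φ.velocity_addPerturb]
  refine ha θ fun w => ?_
  obtain ⟨b, -, h⟩ := exists_perturb_jet hσ hθ 0 w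
  exact ⟨b, h⟩

/-- For almost every coefficient, no coordinate of the velocity vanishes where a free point is
mapped to the axis. -/
theorem ae_velocity_apply_ne_zero (i : ι) (k : Fin 2) :
    ∀ᵐ a ∂coeffMeasure ι, ∀ θ, σ (pt i θ) ≠ pt i θ → φ.addPerturb hσ a (pt i θ) 0 = 0 →
      velocity (φ.addPerturb hσ a) (pt i θ) k ≠ 0 := by
  have hc : ContDiff ℝ 1 fun θ => (φ (pt i θ) 0, velocity φ (pt i θ) k) :=
    (contDiff_coord_comp (φ.contDiff_one_pt i) 0).prodMk
      (contDiff_coord_comp (φ.contDiff_one_velocity_pt i) k)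
  have hA : ContDiff ℝ 1 fun θ => ((coord 0).comp (perturb σ (pt i θ))).prod
      ((coord k).comp (perturbDeriv σ i θ)) :=
    contDiff_clm_prod (contDiff_const.clm_comp (contDiff_one_perturb_pt hσ i))
      (contDiff_const.clm_comp (contDiff_perturbDeriv hσ i))
  filter_upwards [ae_forall_affine_ne_zero hc hA (by simp) (coeffMeasure ι)] with a ha θ hθ h0 hk
  refine ha θ ?_ ?_
  · rintro ⟨p, q⟩
    -- Repeated entries handle both values of k at once; the unused coordinates are arbitrary.
    obtain ⟨b, h1, h2⟩ := exists_perturb_jet hσ hθ !₂[p, p] !₂[q, q]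
    refine ⟨b, Prod.ext ?_ ?_⟩
    · simp [h1]
    · fin_cases k <;> simp [h2]
  · rw [φ.velocity_addPerturb] at hk
    exact Prod.ext h0 hk

/-- For almost every coefficient, there are no tangencies between different free orbits. -/
theorem ae_linearIndependent (i j : ι) :
    ∀ᵐ a ∂coeffMeasure ι, ∀ θ₁ θ₂, σ (pt i θ₁) ≠ pt i θ₁ → pt j θ₂ ≠ pt i θ₁ →
      pt j θ₂ ≠ σ (pt i θ₁) → velocity (φ.addPerturb hσ a) (pt j θ₂) ≠ 0 →
      φ.addPerturb hσ a (pt i θ₁) = φ.addPerturb hσ a (pt j θ₂) →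
      LinearIndependent ℝ ![velocity (φ.addPerturb hσ a) (pt i θ₁),
        velocity (φ.addPerturb hσ a) (pt j θ₂)] := by
  have e1 : ContDiff ℝ 1 fun x : ℝ × ℝ × ℝ => x.1 := contDiff_fst
  have e2 : ContDiff ℝ 1 fun x : ℝ × ℝ × ℝ => x.2.1 := contDiff_fst.comp contDiff_snd
  have e3 : ContDiff ℝ 1 fun x : ℝ × ℝ × ℝ => x.2.2 := contDiff_snd.comp contDiff_snd
  -- The third parameter is the factor of proportionality of the velocities: three parameters
  -- against four equations.
  have hc : ContDiff ℝ 1 fun x : ℝ × ℝ × ℝ => (φ (pt i x.1) - φ (pt j x.2.1),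
      velocity φ (pt i x.1) - x.2.2 • velocity φ (pt j x.2.1)) :=
    (((φ.contDiff_one_pt i).comp e1).sub ((φ.contDiff_one_pt j).comp e2)).prodMk
      (((φ.contDiff_one_velocity_pt i).comp e1).sub
        (e3.smul ((φ.contDiff_one_velocity_pt j).comp e2)))
  have hA : ContDiff ℝ 1 fun x : ℝ × ℝ × ℝ =>
      (perturb σ (pt i x.1) - perturb σ (pt j x.2.1)).prod
        (perturbDeriv σ i x.1 - x.2.2 • perturbDeriv σ j x.2.1) :=
    contDiff_clm_prod (((contDiff_one_perturb_pt hσ i).comp e1).sub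
      ((contDiff_one_perturb_pt hσ j).comp e2))
      (((contDiff_perturbDeriv hσ i).comp e1).sub
        (e3.smul ((contDiff_perturbDeriv hσ j).comp e2)))
  filter_upwards [ae_forall_affine_ne_zero hc hA (by simp) (coeffMeasure ι)]
    with a ha θ₁ θ₂ hfree hne hne' hv he
  rw [LinearIndependent.pair_symm_iff, LinearIndependent.pair_iff' hv]
  intro l hl
  refine ha (θ₁, θ₂, l) ?_ ?_
  · rintro ⟨p, q⟩
    obtain ⟨b, h1, h2, h3, h4⟩ := exists_perturb_jet_pair hσ hfree hne hne' p q
    exact ⟨b, Prod.ext (by simp [h1, h3]) (by simp [h2, h4])⟩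
  · rw [φ.velocity_addPerturb, φ.velocity_addPerturb] at hl
    rw [φ.addPerturb_apply, φ.addPerturb_apply] at he
    refine Prod.ext ?_ ?_
    · calc φ (pt i θ₁) - φ (pt j θ₂) + (perturb σ (pt i θ₁) a - perturb σ (pt j θ₂) a)
          = (φ (pt i θ₁) + perturb σ (pt i θ₁) a) - (φ (pt j θ₂) + perturb σ (pt j θ₂) a) := by
            abel
        _ = 0 := sub_eq_zero.2 he
    · calc velocity φ (pt i θ₁) - l • velocity φ (pt j θ₂) +
            (perturbDeriv σ i θ₁ a - l • perturbDeriv σ j θ₂ a)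
          = (velocity φ (pt i θ₁) + perturbDeriv σ i θ₁ a) -
            l • (velocity φ (pt j θ₂) + perturbDeriv σ j θ₂ a) := by
            rw [smul_add]; abel
        _ = 0 := sub_eq_zero.2 hl.symm

/-- For almost every coefficient, there are no triple points on three different free orbits. -/
theorem ae_no_triple (i j k : ι) :
    ∀ᵐ a ∂coeffMeasure ι, ∀ θ₁ θ₂ θ₃, σ (pt i θ₁) ≠ pt i θ₁ → σ (pt j θ₂) ≠ pt j θ₂ →
      pt i θ₁ ≠ pt j θ₂ → pt i θ₁ ≠ pt k θ₃ → pt j θ₂ ≠ pt k θ₃ →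
      pt i θ₁ ≠ σ (pt j θ₂) → pt i θ₁ ≠ σ (pt k θ₃) → pt j θ₂ ≠ σ (pt k θ₃) →
      φ.addPerturb hσ a (pt i θ₁) = φ.addPerturb hσ a (pt j θ₂) →
      φ.addPerturb hσ a (pt i θ₁) ≠ φ.addPerturb hσ a (pt k θ₃) := by
  have e1 : ContDiff ℝ 1 fun x : ℝ × ℝ × ℝ => x.1 := contDiff_fst
  have e2 : ContDiff ℝ 1 fun x : ℝ × ℝ × ℝ => x.2.1 := contDiff_fst.comp contDiff_snd
  have e3 : ContDiff ℝ 1 fun x : ℝ × ℝ × ℝ => x.2.2 := contDiff_snd.comp contDiff_snd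
  have hc : ContDiff ℝ 1 fun x : ℝ × ℝ × ℝ => (φ (pt i x.1) - φ (pt k x.2.2),
      φ (pt j x.2.1) - φ (pt k x.2.2)) :=
    (((φ.contDiff_one_pt i).comp e1).sub ((φ.contDiff_one_pt k).comp e3)).prodMk
      (((φ.contDiff_one_pt j).comp e2).sub ((φ.contDiff_one_pt k).comp e3))
  have hA : ContDiff ℝ 1 fun x : ℝ × ℝ × ℝ =>
      (perturb σ (pt i x.1) - perturb σ (pt k x.2.2)).prod
        (perturb σ (pt j x.2.1) - perturb σ (pt k x.2.2)) :=
    contDiff_clm_prod (((contDiff_one_perturb_pt hσ i).comp e1).sub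
      ((contDiff_one_perturb_pt hσ k).comp e3))
      (((contDiff_one_perturb_pt hσ j).comp e2).sub ((contDiff_one_perturb_pt hσ k).comp e3))
  filter_upwards [ae_forall_affine_ne_zero hc hA (by simp) (coeffMeasure ι)]
    with a ha θ₁ θ₂ θ₃ hf1 hf2 h12 h13 h23 h12' h13' h23' he he'
  have hswap : ∀ {s t : Circles ι}, s ≠ σ t → t ≠ σ s := fun {s t} h h' =>
    h (by rw [h', hσ.involutive])
  refine ha (θ₁, θ₂, θ₃) ?_ ?_
  · rintro ⟨p, q⟩
    obtain ⟨b, h1, h2, h3⟩ := exists_perturb_jet_triple hσ hf1 h12.symm (hswap h12')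
      h13.symm (hswap h13') p
    obtain ⟨b', h1', h2', h3'⟩ := exists_perturb_jet_triple hσ hf2 h12 h12'
      h23.symm (hswap h23') q
    -- b moves only the first point and b' only the second, so the two differences are independent.
    exact ⟨b + b', Prod.ext (by simp [h1, h3, h2', h3']) (by simp [h2, h3, h1', h3'])⟩
  · have he2 := he.symm.trans he'
    rw [φ.addPerturb_apply, φ.addPerturb_apply] at he' he2
    refine Prod.ext ?_ ?_
    · refine Eq.trans ?_ (sub_eq_zero.2 he')
      simp only [Prod.fst_add, ContinuousLinearMap.prod_apply, sub_apply]
      abel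
    · refine Eq.trans ?_ (sub_eq_zero.2 he2)
      simp only [Prod.snd_add, ContinuousLinearMap.prod_apply, sub_apply]
      abel

/-- For almost every coefficient, different free orbits do not meet on the axis. -/
theorem ae_ne_of_mem_axis (i j : ι) :
    ∀ᵐ a ∂coeffMeasure ι, ∀ θ₁ θ₂, σ (pt i θ₁) ≠ pt i θ₁ → σ (pt j θ₂) ≠ pt j θ₂ →
      pt i θ₁ ≠ pt j θ₂ → pt i θ₁ ≠ σ (pt j θ₂) → φ.addPerturb hσ a (pt i θ₁) 0 = 0 →
      φ.addPerturb hσ a (pt i θ₁) ≠ φ.addPerturb hσ a (pt j θ₂) := by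
  have e1 : ContDiff ℝ 1 fun x : ℝ × ℝ => x.1 := contDiff_fst
  have e2 : ContDiff ℝ 1 fun x : ℝ × ℝ => x.2 := contDiff_snd
  have hc : ContDiff ℝ 1 fun x : ℝ × ℝ => (φ (pt i x.1) 0, φ (pt i x.1) - φ (pt j x.2)) :=
    (contDiff_coord_comp ((φ.contDiff_one_pt i).comp e1) 0).prodMk
      (((φ.contDiff_one_pt i).comp e1).sub ((φ.contDiff_one_pt j).comp e2))
  have hA : ContDiff ℝ 1 fun x : ℝ × ℝ => ((coord 0).comp (perturb σ (pt i x.1))).prod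
      (perturb σ (pt i x.1) - perturb σ (pt j x.2)) :=
    contDiff_clm_prod (contDiff_const.clm_comp ((contDiff_one_perturb_pt hσ i).comp e1))
      (((contDiff_one_perturb_pt hσ i).comp e1).sub ((contDiff_one_perturb_pt hσ j).comp e2))
  filter_upwards [ae_forall_affine_ne_zero hc hA (by simp) (coeffMeasure ι)]
    with a ha θ₁ θ₂ hf1 hf2 h12 h12' h0 he
  have h21' : pt j θ₂ ≠ σ (pt i θ₁) := fun h => h12' (by rw [h, hσ.involutive])
  refine ha (θ₁, θ₂) ?_ ?_
  · rintro ⟨p, q⟩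
    -- The first point moves by (p, 0) and the second by (p, 0) - q, so their difference moves by q.
    -- Two parameters face three equations.
    obtain ⟨b, h1, -, h2, -⟩ := exists_perturb_jet_pair hσ hf1 h12.symm h21' !₂[p, 0] 0
    obtain ⟨b', h1', -, h2', -⟩ := exists_perturb_jet_pair hσ hf2 h12 h12' (!₂[p, 0] - q) 0
    exact ⟨b + b', Prod.ext (by simp [h1, h2']) (by simp [h1, h2, h1', h2'])⟩
  · rw [φ.addPerturb_apply, φ.addPerturb_apply] at he
    refine Prod.ext h0 (Eq.trans ?_ (sub_eq_zero.2 he))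
    simp only [Prod.snd_add, ContinuousLinearMap.prod_apply, sub_apply]
    abel

/-- For almost every coefficient, a given fixed point does not meet the free orbits. -/
theorem ae_ne_of_fixed (i : ι) {s : Circles ι} (hs : σ s = s) :
    ∀ᵐ a ∂coeffMeasure ι, ∀ θ, σ (pt i θ) ≠ pt i θ →
      φ.addPerturb hσ a (pt i θ) ≠ φ.addPerturb hσ a s := by
  have hc : ContDiff ℝ 1 fun θ => φ (pt i θ) - φ s := (φ.contDiff_one_pt i).sub contDiff_const
  have hA : ContDiff ℝ 1 fun θ => perturb σ (pt i θ) - perturb σ s :=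
    (contDiff_one_perturb_pt hσ i).sub contDiff_const
  filter_upwards [ae_forall_affine_ne_zero hc hA (by simp) (coeffMeasure ι)] with a ha θ hθ he
  obtain ⟨j, θ', rfl⟩ := exists_pt_eq s
  have hne : pt j θ' ≠ pt i θ := fun h => hθ (h ▸ hs)
  have hne' : pt j θ' ≠ σ (pt i θ) := fun h => hne (by rw [← hs, h, hσ.involutive])
  refine ha θ ?_ ?_
  · intro p
    obtain ⟨b, h1, -, h2, -⟩ := exists_perturb_jet_pair hσ hθ hne hne' p 0
    exact ⟨b, by simp [h1, h2]⟩
  · rw [φ.addPerturb_apply, φ.addPerturb_apply] at he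
    refine Eq.trans ?_ (sub_eq_zero.2 he)
    simp only [sub_apply]
    abel

/-- A nonzero functional is generically nonzero on an affine family. -/
theorem ae_add_apply_ne_zero (c : ℝ) {l : Coeffs ι →L[ℝ] ℝ} (hl : Function.Surjective l) :
    ∀ᵐ a ∂coeffMeasure ι, c + l a ≠ 0 := by
  -- The parameter space is a single point, of dimension 0 < 1.
  filter_upwards [ae_forall_affine_ne_zero (X := Fin 0 → ℝ) (c := fun _ => c) (A := fun _ => l)
    contDiff_const contDiff_const (by simp) (coeffMeasure ι)] with a ha
  exact ha 0 hl

theorem ae_velocity_ne_zero_of_fixed {s : Circles ι} (hs : σ s = s) :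
    ∀ᵐ a ∂coeffMeasure ι, velocity (φ.addPerturb hσ a) s ≠ 0 := by
  obtain ⟨i, θ, rfl⟩ := exists_pt_eq s
  have hsurj : Function.Surjective ((coord 0).comp (perturbDeriv σ i θ)) := fun r =>
    exists_perturbDeriv_of_fixed hσ hs r
  filter_upwards [ae_add_apply_ne_zero (velocity φ (pt i θ) 0) hsurj] with a ha h
  rw [φ.velocity_addPerturb] at h
  exact ha (congrArg (fun v : Plane => v 0) h)

theorem ae_ne_of_fixed_of_fixed {s t : Circles ι} (hs : σ s = s) (ht : σ t = t) (hst : s ≠ t) :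
    ∀ᵐ a ∂coeffMeasure ι, φ.addPerturb hσ a s ≠ φ.addPerturb hσ a t := by
  have hsurj : Function.Surjective ((coord 1).comp (perturb σ s - perturb σ t)) := fun r => by
    obtain ⟨b, h1, h2⟩ := exists_perturb_of_fixed hs ht hst r
    exact ⟨b, by simp [h1, h2]⟩
  filter_upwards [ae_add_apply_ne_zero (φ s 1 - φ t 1) hsurj] with a ha h
  rw [φ.addPerturb_apply, φ.addPerturb_apply] at h
  refine ha ?_
  have := congrArg (fun v : Plane => v 1) h
  simp only [PiLp.add_apply] at this
  change φ s 1 - φ t 1 + (perturb σ s a 1 - perturb σ t a 1) = 0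
  linarith

/-- Almost every equivariant perturbation of an equivariant smooth map is equivariantly
regular. -/
theorem ae_mem_equivariantRegularMaps (hφ : IsEquivariant σ φ) :
    ∀ᵐ a ∂coeffMeasure ι, φ.addPerturb hσ a ∈ equivariantRegularMaps σ := by
  have hfix : {t | σ t = t}.Countable := (finite_fixedPoints hσ).countable
  filter_upwards [ae_all_iff.2 fun i => ae_velocity_ne_zero φ hσ i,
    ae_all_iff.2 fun i => ae_velocity_apply_ne_zero φ hσ i 0,
    ae_all_iff.2 fun i => ae_velocity_apply_ne_zero φ hσ i 1,
    ae_all_iff.2 fun i => ae_all_iff.2 fun j => ae_linearIndependent φ hσ i j,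
    ae_all_iff.2 fun i => ae_all_iff.2 fun j => ae_all_iff.2 fun k => ae_no_triple φ hσ i j k,
    ae_all_iff.2 fun i => ae_all_iff.2 fun j => ae_ne_of_mem_axis φ hσ i j,
    ae_all_iff.2 fun i => (ae_ball_iff hfix).2 fun s hs => ae_ne_of_fixed φ hσ i hs,
    (ae_ball_iff hfix).2 fun s hs => ae_velocity_ne_zero_of_fixed φ hσ hs,
    (ae_ball_iff hfix).2 fun s hs => (ae_ball_iff (hfix.mono sdiff_subset)).2
      fun t (ht : t ∈ {t | σ t = t} \ {s}) =>
        ae_ne_of_fixed_of_fixed φ hσ hs ht.1 (Ne.symm ht.2)]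
    with a h1 h4 h5 h2 h3 h6 h8 h7 hinj
  have heq := SmoothMap.isEquivariant_addPerturb hφ hσ a
  set ψ := φ.addPerturb hσ a
  have hfree : ∀ t, ψ t ∉ axis → σ t ≠ t := fun t ht h => ht (map_mem_axis_of_fixed heq h)
  -- Points exchanged by σ have mirror images, which coincide only on the axis.
  have horbit : ∀ s t, ψ s ∉ axis → ψ s = ψ t → s ≠ σ t := by
    rintro s t hs he rfl
    rw [heq, reflection_eq_self_iff] at he
    exact hs (by rw [heq, reflection_eq_self_iff.2 he]; exact he)
  refine ⟨⟨heq, fun s hs t ht he => ?_⟩, ⟨fun t ht => ?_, fun w hw t₁ t₂ hne hpre => ?_,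
    fun w hw => encard_preimage_le_two_iff.2 fun t₁ t₂ t₃ h12 h13 h23 e1 e2 e3 => ?_,
    fun t ht hax => ?_, fun t ht hax hv => ?_, fun t₁ t₂ ht₁ ht₂ hax₁ _ hno => ?_,
    fun t ht => h7 t ht, disjoint_image_image_iff.2 fun t ht s hs => ?_⟩⟩
  · by_contra hne
    exact hinj s hs t ⟨ht, Ne.symm hne⟩ he
  · obtain ⟨i, θ, rfl⟩ := exists_pt_eq t
    exact h1 i θ ht
  · have e1 : ψ t₁ = w := by
      have : t₁ ∈ ψ ⁻¹' {w} := by rw [hpre]; simp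
      exact this
    have e2 : ψ t₂ = w := by
      have : t₂ ∈ ψ ⁻¹' {w} := by rw [hpre]; simp
      exact this
    have hw1 : ψ t₁ ∉ axis := e1.symm ▸ hw
    have hw2 : ψ t₂ ∉ axis := e2.symm ▸ hw
    have ho := horbit t₂ t₁ hw2 (e2.trans e1.symm)
    have he := e1.trans e2.symm
    obtain ⟨i, θ₁, rfl⟩ := exists_pt_eq t₁
    obtain ⟨j, θ₂, rfl⟩ := exists_pt_eq t₂
    exact h2 i j θ₁ θ₂ (hfree _ hw1) hne.symm ho (h1 j θ₂ (hfree _ hw2)) he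
  · have hw1 : ψ t₁ ∉ axis := e1.symm ▸ hw
    have hw2 : ψ t₂ ∉ axis := e2.symm ▸ hw
    have o12 := horbit t₁ t₂ hw1 (e1.trans e2.symm)
    have o13 := horbit t₁ t₃ hw1 (e1.trans e3.symm)
    have o23 := horbit t₂ t₃ hw2 (e2.trans e3.symm)
    have he := e1.trans e2.symm
    have he' := e1.trans e3.symm
    obtain ⟨i, θ₁, rfl⟩ := exists_pt_eq t₁
    obtain ⟨j, θ₂, rfl⟩ := exists_pt_eq t₂
    obtain ⟨k, θ₃, rfl⟩ := exists_pt_eq t₃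
    exact h3 i j k θ₁ θ₂ θ₃ (hfree _ hw1) (hfree _ hw2) h12 h13 h23 o12 o13 o23 he he'
  · obtain ⟨i, θ, rfl⟩ := exists_pt_eq t
    exact h4 i θ ht hax
  · obtain ⟨i, θ, rfl⟩ := exists_pt_eq t
    exact h5 i θ ht hax (mem_axis_orthogonal.1 hv)
  · rw [not_or] at hno
    obtain ⟨i, θ₁, rfl⟩ := exists_pt_eq t₁
    obtain ⟨j, θ₂, rfl⟩ := exists_pt_eq t₂
    exact h6 i j θ₁ θ₂ ht₁ ht₂ hno.1 hno.2 hax₁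
  · obtain ⟨i, θ, rfl⟩ := exists_pt_eq t
    exact h8 i s hs θ ht

end Families

theorem dense_equivariantRegularMaps {ι : Type*} [Finite ι] {σ : Circles ι → Circles ι}
    (hσ : IsSmoothInvolution σ) :
    Dense {φ : equivariantMaps σ | (φ : SmoothMap ι) ∈ equivariantRegularMaps σ} := by
  have := Fintype.ofFinite ι
  intro φ
  rw [closure_subtype]
  have hdense : Dense {a : Coeffs ι | (φ : SmoothMap ι).addPerturb hσ a ∈
      equivariantRegularMaps σ} :=
    Measure.dense_of_ae (ae_mem_equivariantRegularMaps (φ : SmoothMap ι) hσ φ.2.1)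
  have h0 : (φ : SmoothMap ι).addPerturb hσ 0 = φ := by
    obtain ⟨⟨f, hf⟩, hφ⟩ := φ
    simp [SmoothMap.addPerturb]
  rw [← h0]
  -- The zero coefficient, which gives φ itself, is a limit of good coefficients.
  refine closure_mono ?_ (mem_closure_image
    ((φ : SmoothMap ι).continuous_addPerturb hσ).continuousAt (hdense 0))
  rintro _ ⟨a, ha, rfl⟩
  exact ⟨⟨_, ha.1⟩, ha, rfl⟩

end InvolutiveDiagram

end

theorem mainTheorem10 {ι : Type*} [Finite ι]
    (σ : InvolutiveDiagram.Circles ι → InvolutiveDiagram.Circles ι)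
    (hσ : InvolutiveDiagram.IsSmoothInvolution σ) :
    (IsOpen {φ : InvolutiveDiagram.equivariantMaps σ |
        (φ : InvolutiveDiagram.SmoothMap ι) ∈ InvolutiveDiagram.equivariantRegularMaps σ} ∧
      Dense {φ : InvolutiveDiagram.equivariantMaps σ |
        (φ : InvolutiveDiagram.SmoothMap ι) ∈ InvolutiveDiagram.equivariantRegularMaps σ}) ∧
    (∀ φ : InvolutiveDiagram.SmoothMap ι, InvolutiveDiagram.IsEquivariant σ φ →
      (φ ∈ InvolutiveDiagram.equivariantRegularMaps σ ↔ InvolutiveDiagram.IsRegular φ)) :=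
  ⟨⟨InvolutiveDiagram.isOpen_equivariantRegularMaps hσ,
    InvolutiveDiagram.dense_equivariantRegularMaps hσ⟩,
    fun _ hφ => InvolutiveDiagram.mem_equivariantRegularMaps_iff hσ hφ⟩
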